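/- Setting. Let $\varepsilon$ be given and let $\lambda_\varepsilon$ be a probability measure on $[-\varepsilon,\varepsilon]$. Let $U\subseteq\mathbb R^3$ be open and, for each $\eta\in[-\varepsilon,\varepsilon]$, let $\phi_\eta$ be a $C^1$ vector field on $U$ for which $U$ is forward invariant; $\Phi_\eta^t:U\to U$, $t\ge 0$, denotes the semiflow generated by $\phi_\eta$, which is assumed to be jointly measurable in $(\eta,t,y)$. (This includes the random perturbations $\phi_\eta$ of the classical Lorenz field, with $U$ a neighbourhood of the attractor.) Let $\mathcal M\subseteq U$ be a closed cross-section, i.e. for every $y\in U$ and $\lambda_\varepsilon$-a.e. $\eta$ the hitting time $\hat\tau_\eta(y)=\inf\{t\ge0:\Phi^t_\eta(y)\in\mathcal M\}$ is finite, and for every $x\in\mathcal M$ and $\lambda_\varepsilon$-a.e. $\eta$ there is a first strictly positive return time $\tau_\eta(x)=\min\{t>0:\Phi_\eta^t(x)\in\mathcal M\}<\infty$. Put $R_\eta(x)=\Phi_\eta^{\tau_\eta(x)}(x)$ and $F^\varepsilon_\tau(s;x)=\lambda_\varepsilon\{\eta:\tau_\eta(x)\le s\}$. For a sequence $(\eta_n)_{n\ge0}$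 of i.i.d. random variables with law $\lambda_\varepsilon$ and $x\in\mathcal M$ let $\mathfrak x_0=x$, $\mathfrak x_{n+1}=R_{\eta_n}(\mathfrak x_n)$, $\sigma_0=0$, $\sigma_n=\sum_{i=0}^{n-1}\tau_{\eta_i}(\mathfrak x_i)$, $\mathbf N_t=\#\{n\ge1:\sigma_n\le t\}$. Assume that the Markov chain $(\mathfrak x_n)$ on $\mathcal M$ is Harris recurrent: there is a $\sigma$-finite measure $\psi\neq0$ on $\mathcal M$ such that, for every measurable $A\subseteq\mathcal M$ with $\psi(A)>0$ and every starting point $x\in\mathcal M$, almost surely $\mathfrak x_n\in A$ for infinitely many $n$. Let $\nu_2^\varepsilon$ be a stationary probability measure of this chain, and assume that $(\eta,x)\mapsto\tau_\eta(x)$ is integrable with respect to $\lambda_\varepsilon\otimes\nu_2^\varepsilon$. For $y_0\in U$ let $(\mathfrak u_t(y_0))_{t\ge0}$ be the following piecewise deterministic process: with $\eta$ of law $\lambda_\varepsilon$ independent of the i.i.d. sequence $(\eta_n)_{n\ge0}$, one has $\mathfrak u_t(y_0)=\Phi_\eta^t(y_0)$ for $0\le t<\hat\tau_\eta(y_0)$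 and $$\mathfrak u_t(y_0)=\Phi_{\eta_{\mathbf N_{r}}}^{\,r-\sigma_{\mathbf N_{r}}}\big(\mathfrak x_{\mathbf N_{r}}\big),\qquad r=t-\hat\tau_\eta(y_0)\ge0,\quad \mathfrak x_0=\Phi_\eta^{\hat\tau_\eta(y_0)}(y_0)$$ (so that $\mathfrak x_0=y_0$ and $r=t$ if $y_0\in\mathcal M$). Statement. For every bounded measurable function $f:U\to\mathbb R$ and every $y_0\in U$, the denominator below is strictly positive and, almost surely, $s\mapsto f(\mathfrak u_s(y_0))$ is integrable on each bounded interval $[0,t]$ and $$\lim_{t\to\infty}\frac1t\int_0^t f\circ\mathfrak u_s(y_0)\,ds=\frac{\int_{[-\varepsilon,\varepsilon]}\lambda_\varepsilon(d\eta)\int_{\mathcal M}\nu_2^\varepsilon(dx)\int_0^{\tau_\eta(x)}f\big(\Phi_\eta^s(x)\big)\,ds}{\int_{\mathcal M}\nu_2^\varepsilon(dx)\int_0^\infty\big(1-F_\tau^\varepsilon(s;x)\big)\,ds}.$$ -/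

import Mathlib

open MeasureTheory ProbabilityTheory Filter Topology

namespace LorenzPDMP

/-- The phase space `ℝ³` with its Euclidean norm. -/
abbrev Phase : Type := EuclideanSpace ℝ (Fin 3)

/-- The set `[-ε, ε]` of realizations of the noise. -/
abbrev Noise (ε : ℝ) : Type := Set.Icc (-ε) ε

/-- `Φ η t y` is, for `t ≥ 0` and `y ∈ U`, the value at time `t` of the solution started at `y` of
the ordinary differential equation with the `C¹` phase field `φ η`; the set `U` is forward invariant
for every realization `η`, and `Φ` is jointly measurable. Nothing is required of `Φ η t y` for
`t < 0` or `y ∉ U`. -/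
structure IsSemiflowFamily {ε : ℝ} (U : Set Phase) (φ : Noise ε → Phase → Phase)
    (Φ : Noise ε → ℝ → Phase → Phase) : Prop where
  contDiffOn_field : ∀ η, ContDiffOn ℝ 1 (φ η) U
  apply_zero : ∀ η, ∀ y ∈ U, Φ η 0 y = y
  mem_of_nonneg : ∀ η, ∀ y ∈ U, ∀ t, 0 ≤ t → Φ η t y ∈ U
  hasDeriv : ∀ η, ∀ y ∈ U, ∀ t, 0 ≤ t →
    HasDerivWithinAt (fun s => Φ η s y) (φ η (Φ η t y)) (Set.Ici 0) t
  measurable : Measurable fun p : Noise ε × Set.Ici (0 : ℝ) × U => Φ p.1 p.2.1 p.2.2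

section Dynamics

variable {ε : ℝ} (Φ : Noise ε → ℝ → Phase → Phase) (M : Set Phase)

/-- The hitting time `τ̂_η(y)` of `M` by the `η`-flow (it is `0` for `y ∈ M`). -/
noncomputable def hittingTime (η : Noise ε) (y : Phase) : ℝ :=
  sInf {t : ℝ | 0 ≤ t ∧ Φ η t y ∈ M}

/-- The return time `τ_η(x)` on `M` of the `η`-flow. -/
noncomputable def returnTime (η : Noise ε) (x : Phase) : ℝ :=
  sInf {t : ℝ | 0 < t ∧ Φ η t x ∈ M}

/-- The return map `R_η(x) = Φ_η^{τ_η(x)}(x)`. -/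
noncomputable def returnMap (η : Noise ε) (x : Phase) : Phase :=
  Φ η (returnTime Φ M η x) x

/-- `M` is a closed cross-section in `U` for the randomly perturbed flow: from every point of `U`
the section is almost surely reached, and from every point of `M` there is almost surely a first
strictly positive return time to `M`. -/
structure IsCrossSection (U : Set Phase) (lam : Measure (Noise ε)) : Prop where
  isClosed : IsClosed M
  subset : M ⊆ U
  hits : ∀ y ∈ U, ∀ᵐ η ∂lam, ∃ t, 0 ≤ t ∧ Φ η t y ∈ M
  returns : ∀ x ∈ M, ∀ᵐ η ∂lam, ∃ t, IsLeast {t : ℝ | 0 < t ∧ Φ η t x ∈ M} t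

/-- The chain `𝔵₀ = x`, `𝔵ₙ₊₁ = R_{ηₙ}(𝔵ₙ)` driven by the noise sequence `η`. -/
noncomputable def chain (η : ℕ → Noise ε) (x : Phase) : ℕ → Phase
  | 0 => x
  | n + 1 => returnMap Φ M (η n) (chain η x n)

/-- The renewal times `σₙ = τ_{η₀}(𝔵₀) + ⋯ + τ_{ηₙ₋₁}(𝔵ₙ₋₁)` of the chain started at `x ∈ M`;
the empty sum gives `σ₀ = 0`. -/
noncomputable def renewalTime (η : ℕ → Noise ε) (x : Phase) (n : ℕ) : ℝ :=
  ∑ i ∈ Finset.range n, returnTime Φ M (η i) (chain Φ M η x i)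

/-- The counting process: the number of renewals `σ₁, σ₂, …` that occur in `[0, t]`. -/
noncomputable def renewalCount (η : ℕ → Noise ε) (x : Phase) (t : ℝ) : ℕ :=
  Set.ncard {n : ℕ | renewalTime Φ M η x (n + 1) ≤ t}

/-- The age `𝔩ₜ = t - σ_{Nₜ}`. -/
noncomputable def age (η : ℕ → Noise ε) (x : Phase) (t : ℝ) : ℝ :=
  t - renewalTime Φ M η x (renewalCount Φ M η x t)

/-- The process `Φ_{η_{Nₜ}}^{𝔩ₜ}(𝔵_{Nₜ})` started at `x ∈ M`. -/
noncomputable def evolutionFromSection (η : ℕ → Noise ε) (x : Phase) (t : ℝ) : Phase :=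
  Φ (η (renewalCount Φ M η x t)) (age Φ M η x t) (chain Φ M η x (renewalCount Φ M η x t))

/-- The piecewise deterministic process `𝔲ₜ(y)`, `y ∈ U`: the orbit follows the flow with noise
`η 0` up to the hitting time of `M`, and from the hitting point on it evolves with the noises
`η 1, η 2, …`, the noise being renewed at each return to `M`. For `y ∈ M` the first phase has
length `0`. -/
noncomputable def pdmp (η : ℕ → Noise ε) (y : Phase) (t : ℝ) : Phase :=
  if t < hittingTime Φ M (η 0) y then Φ (η 0) t y
  else evolutionFromSection Φ M (fun n => η (n + 1)) (Φ (η 0) (hittingTime Φ M (η 0) y) y)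
    (t - hittingTime Φ M (η 0) y)

/-- Harris recurrence of the chain on `M` driven by i.i.d. noise of law `lam`: for some nontrivial
σ-finite measure `ψ` on `M`, every measurable set `A ⊆ M` of positive `ψ`-measure is visited
infinitely often with probability one from every starting point `x ∈ M`. -/
def HarrisRecurrent (lam : Measure (Noise ε)) [IsProbabilityMeasure lam] : Prop :=
  ∃ ψ : Measure Phase, SigmaFinite ψ ∧ 0 < ψ M ∧
    ∀ A : Set Phase, MeasurableSet A → A ⊆ M → 0 < ψ A → ∀ x ∈ M,
      ∀ᵐ η ∂(Measure.infinitePi fun _ : ℕ => lam), ∃ᶠ n in atTop, chain Φ M η x n ∈ A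

/-- `ν` is a stationary probability measure on `M` for the chain with transition probability
`x, A ↦ lam {η | R_η(x) ∈ A}`. -/
structure IsStationary (lam : Measure (Noise ε)) (ν : Measure Phase) : Prop where
  isProbabilityMeasure : IsProbabilityMeasure ν
  compl_eq_zero : ν Mᶜ = 0
  lintegral_transition : ∀ A : Set Phase, MeasurableSet A →
    ∫⁻ x in M, lam {η | returnMap Φ M η x ∈ A} ∂ν = ν A

/-- The distribution function `F_τ(t; x) = lam {η | τ_η(x) ≤ t}` of the return time. -/
noncomputable def returnTimeCDF (lam : Measure (Noise ε)) (t : ℝ) (x : Phase) : ℝ :=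
  lam.real {η | returnTime Φ M η x ≤ t}

end Dynamics

end LorenzPDMP

/-! The process is a renewal-reward process over the Markov chain of returns to `M`. Each excursion
has a length, the return time, and a reward, the integral of `f` along it. Suppose the averages of
lengths and rewards over the first `n` excursions converge to their means `m` and `γ` under
`lam.prod ν`. Then `n` excursions take time about `n * m` and contribute about `n * γ`. Since `f` is
bounded, the unfinished excursion is negligible, and the time average tends to `γ / m`
(`tendsto_time_average_of_pieces`). The stated denominator is `m` by the layer-cake formula.

The substance is a law of large numbers that holds from every starting point, not only from
`ν`-almost every one (`tendsto_average_of_recurrent`). It combines two facts. First, under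
recurrence a shift-invariant event has probability zero from all starting points or probability one
from all of them (`zero_one_of_recurrent`): its probability from the current state converges, by
Lévy's upward theorem, to the indicator of the event, while recurrence brings the chain back forever
to one side of the level 1/2. Second, Birkhoff sums that are almost everywhere unbounded above force
a nonnegative integral (`integral_nonneg_of_birkhoffSum_not_bddAbove`). So a reward of negative mean
has sums bounded above from every starting point; centring the reward and changing its sign gives
both halves of the limit.

Conventions such as `sInf ∅ = 0` make the return map a measurable self-map of all of `M`. The random
hitting point is handled by Fubini, because it depends only on the first noise. -/

namespace RandomIteration

/-! ### Random iterations, the skew product and the zero-one law -/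

section Orbit

variable {N S : Type*}

/-- The orbit `x₀ = x`, `xₙ₊₁ = R (ηₙ) xₙ` of a random iteration driven by the sequence `η`. -/
def orbit (R : N → S → S) (η : ℕ → N) (x : S) : ℕ → S
  | 0 => x
  | n + 1 => R (η n) (orbit R η x n)

/-- The skew product over the shift that generates the random iteration. -/
def skew (R : N → S → S) (p : S × (ℕ → N)) : S × (ℕ → N) :=
  (R (p.2 0) p.1, fun n => p.2 (n + 1))

lemma skew_iterate (R : N → S → S) (x : S) (η : ℕ → N) (n : ℕ) :
    (skew R)^[n] (x, η) = (orbit R η x n, fun k => η (k + n)) := by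
  induction n with
  | zero => simp [orbit]
  | succ n ih =>
    rw [Function.iterate_succ_apply', ih]
    simp only [skew, orbit, zero_add, Prod.mk.injEq, true_and]
    funext k
    congr 1
    omega

variable [MeasurableSpace N] [MeasurableSpace S]

lemma measurable_skew {R : N → S → S} (hR : Measurable fun p : N × S => R p.1 p.2) :
    Measurable (skew R) := by
  unfold skew
  have h : Measurable fun p : S × (ℕ → N) => (p.2 0, p.1) := by fun_prop
  exact (hR.comp h).prodMk (by fun_prop)

/-- The information carried by the first `n` coordinates. -/
def prefixFiltration : Filtration ℕ (inferInstance : MeasurableSpace (ℕ → N)) where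
  seq n := ⨆ i ∈ Set.Iio n, MeasurableSpace.comap (fun η : ℕ → N => η i) inferInstance
  mono' _ _ h := biSup_mono fun _ hi => lt_of_lt_of_le hi h
  le' _ := iSup₂_le fun i _ => (measurable_pi_apply i).comap_le

lemma iSup_prefixFiltration :
    (⨆ n, (prefixFiltration (N := N)) n) = (inferInstance : MeasurableSpace (ℕ → N)) := by
  apply le_antisymm (iSup_le fun n => prefixFiltration.le n)
  refine iSup_le fun i => ?_
  refine le_trans ?_ (le_iSup _ (i + 1))
  exact le_iSup₂_of_le (f := fun j (_ : j ∈ Set.Iio (i + 1)) =>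
    MeasurableSpace.comap (fun η : ℕ → N => η j) inferInstance) i (Nat.lt_succ_self i) le_rfl

lemma measurable_eval_prefixFiltration {i n : ℕ} (h : i < n) :
    Measurable[prefixFiltration (N := N) n] fun η : ℕ → N => η i := by
  rw [measurable_iff_comap_le]
  exact le_iSup₂_of_le (f := fun j (_ : j ∈ Set.Iio n) =>
    MeasurableSpace.comap (fun η : ℕ → N => η j) inferInstance) i h le_rfl

lemma measurable_orbit {R : N → S → S} (hR : Measurable fun p : N × S => R p.1 p.2) (x : S)
    (n : ℕ) : Measurable[prefixFiltration n] fun η : ℕ → N => orbit R η x n := by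
  induction n with
  | zero => exact measurable_const
  | succ n ih =>
    have h1 : Measurable[prefixFiltration (n + 1)] fun η : ℕ → N => orbit R η x n :=
      ih.mono (prefixFiltration.mono n.le_succ) le_rfl
    exact hR.comp ((measurable_eval_prefixFiltration n.lt_succ_self).prodMk h1)

variable (lam : Measure N) [IsProbabilityMeasure lam]

lemma map_shift (n : ℕ) :
    (Measure.infinitePi fun _ : ℕ => lam).map (fun η k => η (k + n)) =
      Measure.infinitePi fun _ : ℕ => lam :=
  Measure.map_infinitePi_infinitePi_of_inj (P := fun _ : ℕ => lam) (f := fun k => k + n)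
    (add_left_injective n)

lemma indep_prefix_shift (n : ℕ) :
    Indep (prefixFiltration (N := N) n)
      (MeasurableSpace.comap (fun (η : ℕ → N) k => η (k + n)) inferInstance)
      (Measure.infinitePi fun _ : ℕ => lam) := by
  have h := iIndepFun_infinitePi (P := fun _ : ℕ => lam) (X := fun _ => id)
    (fun _ => measurable_id)
  have h2 := indep_iSup_of_disjoint (fun i => (measurable_pi_apply i).comap_le)
    h.iIndep (S := Set.Iio n) (T := Set.Ici n)
    (Set.disjoint_left.2 fun _ h1 h2 => absurd (Set.mem_Iio.1 h1) (not_lt.2 (Set.mem_Ici.1 h2)))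
  refine indep_of_indep_of_le_right h2 ?_
  rw [← measurable_iff_comap_le]
  refine @measurable_pi_lambda _ _ _ (_) _ _ fun k => ?_
  rw [measurable_iff_comap_le]
  exact le_iSup₂_of_le (f := fun j (_ : j ∈ Set.Ici n) =>
    MeasurableSpace.comap (fun η : ℕ → N => η j) inferInstance) (k + n) (Nat.le_add_left n k) le_rfl

/-- A quantity determined by the first `n` coordinates and the sequence of the remaining ones have
a product law. -/
lemma map_prefix_shift {Y : Type*} [MeasurableSpace Y] {n : ℕ} {g : (ℕ → N) → Y}
    (hg : Measurable[prefixFiltration n] g) :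
    (Measure.infinitePi fun _ : ℕ => lam).map (fun η => (g η, fun k => η (k + n))) =
      ((Measure.infinitePi fun _ : ℕ => lam).map g).prod (Measure.infinitePi fun _ : ℕ => lam) := by
  have hg' : Measurable g := hg.mono (prefixFiltration.le n) le_rfl
  have h := (indepFun_iff_map_prod_eq_prod_map_map (μ := Measure.infinitePi fun _ : ℕ => lam)
    (f := g) (g := fun (η : ℕ → N) k => η (k + n)) hg'.aemeasurable
      (measurable_pi_lambda _ fun _ => measurable_pi_apply _).aemeasurable).1 ?_
  · rw [h, map_shift]
  · exact indep_of_indep_of_le_left (indep_prefix_shift lam n) hg.comap_le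

/-- The first noise is independent of the shifted sequence, which has the same law; invariance of
`ν` under one random step absorbs the first noise together with the starting point. -/
lemma measurePreserving_skew {R : N → S → S} (hR : Measurable fun p : N × S => R p.1 p.2)
    {ν : Measure S} [IsProbabilityMeasure ν]
    (hν : (lam.prod ν).map (fun p => R p.1 p.2) = ν) :
    MeasurePreserving (skew R) (ν.prod (Measure.infinitePi fun _ : ℕ => lam))
      (ν.prod (Measure.infinitePi fun _ : ℕ => lam)) := by
  refine ⟨measurable_skew hR, ?_⟩
  have h1 : (Measure.infinitePi fun _ : ℕ => lam).map (fun η => (η 0, fun k => η (k + 1))) =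
      lam.prod (Measure.infinitePi fun _ : ℕ => lam) := by
    rw [map_prefix_shift lam (n := 1) (g := fun η : ℕ → N => η 0)
      (measurable_eval_prefixFiltration Nat.one_pos), Measure.infinitePi_map_eval]
  set μ := Measure.infinitePi fun _ : ℕ => lam
  have h2 : skew R = (fun q : (N × S) × (ℕ → N) => (R q.1.1 q.1.2, q.2)) ∘
      (fun q : S × (N × (ℕ → N)) => ((q.2.1, q.1), q.2.2)) ∘
      Prod.map id (fun η : ℕ → N => (η 0, fun k => η (k + 1))) := rfl
  have hm1 : Measurable fun q : (N × S) × (ℕ → N) => (R q.1.1 q.1.2, q.2) :=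
    (hR.comp measurable_fst).prodMk measurable_snd
  have hm2 : Measurable fun q : S × (N × (ℕ → N)) => ((q.2.1, q.1), q.2.2) := by fun_prop
  have hm3 : Measurable fun η : ℕ → N => (η 0, fun k => η (k + 1)) := by fun_prop
  have hm4 : Measurable (Prod.map (id : S → S) fun η : ℕ → N => (η 0, fun k => η (k + 1))) :=
    measurable_id.prodMap hm3
  rw [h2, ← Measure.map_map hm1 (hm2.comp hm4), ← Measure.map_map hm2 hm4,
    ← Measure.map_prod_map _ _ measurable_id hm3, Measure.map_id, h1]
  have h3 : (ν.prod (lam.prod μ)).map (fun q : S × (N × (ℕ → N)) => ((q.2.1, q.1), q.2.2)) =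
      (lam.prod ν).prod μ := by
    have e1 : (fun q : S × (N × (ℕ → N)) => ((q.2.1, q.1), q.2.2)) =
        Prod.map Prod.swap id ∘ MeasurableEquiv.prodAssoc.symm := rfl
    rw [e1, ← Measure.map_map (measurable_swap.prodMap measurable_id) (MeasurableEquiv.measurable _)]
    rw [← Measure.prodAssoc_prod, MeasurableEquiv.map_symm_map,
      ← Measure.map_prod_map _ _ measurable_swap measurable_id, Measure.prod_swap, Measure.map_id]
  rw [h3]
  have e2 : (fun q : (N × S) × (ℕ → N) => (R q.1.1 q.1.2, q.2)) =
      Prod.map (fun p : N × S => R p.1 p.2) id := rfl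
  rw [e2, ← Measure.map_prod_map _ _ hR measurable_id, hν, Measure.map_id]

/-- Invariant events of a recurrent random iteration have probability zero from all starting
points, or probability one from all starting points. -/
theorem zero_one_of_recurrent {R : N → S → S} (hR : Measurable fun p : N × S => R p.1 p.2)
    {ψ : Measure S} (hψ : ψ ≠ 0)
    (hrec : ∀ A : Set S, MeasurableSet A → 0 < ψ A → ∀ x,
      ∀ᵐ η ∂(Measure.infinitePi fun _ : ℕ => lam), ∃ᶠ n in atTop, orbit R η x n ∈ A)
    {E : Set (S × (ℕ → N))} (hE : MeasurableSet E) (hinv : skew R ⁻¹' E = E) :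
    (∀ x, ∀ᵐ η ∂(Measure.infinitePi fun _ : ℕ => lam), (x, η) ∈ E) ∨
      (∀ x, ∀ᵐ η ∂(Measure.infinitePi fun _ : ℕ => lam), (x, η) ∉ E) := by
  set μ := Measure.infinitePi fun _ : ℕ => lam with hμ
  set h : S → ℝ := fun x => μ.real (Prod.mk x ⁻¹' E) with hh
  have hh_meas : Measurable h := (measurable_measure_prodMk_left hE).ennreal_toReal
  have hh_bdd : ∀ x, |h x| ≤ 1 := fun x => by
    rw [abs_of_nonneg measureReal_nonneg]; exact measureReal_le_one
  -- Invariance lets membership in `E` be decided after `n` steps, from the current state and the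
  -- remaining noise.
  have hiter : ∀ n x (η : ℕ → N), (orbit R η x n, fun k => η (k + n)) ∈ E ↔ (x, η) ∈ E := by
    intro n x η
    rw [← skew_iterate]
    have : (skew R)^[n] ⁻¹' E = E := by
      induction n with
      | zero => rfl
      | succ n ih => rw [Function.iterate_succ', Set.preimage_comp, hinv, ih]
    exact Set.ext_iff.1 this (x, η)
  -- By `hiter` and independence, `h` at time `n` is the conditional probability of `E` given the
  -- first `n` noises; Lévy's upward theorem gives the limit.
  have hlevy : ∀ x, ∀ᵐ η ∂μ, Tendsto (fun n => h (orbit R η x n)) atTop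
      (𝓝 ((Prod.mk x ⁻¹' E).indicator (fun _ => (1 : ℝ)) η)) := by
    intro x
    have hEx : MeasurableSet (Prod.mk x ⁻¹' E) := measurable_prodMk_left hE
    have hint : Integrable ((Prod.mk x ⁻¹' E).indicator (fun _ => (1 : ℝ))) μ :=
      (integrable_const 1).indicator hEx
    have hsm : StronglyMeasurable ((Prod.mk x ⁻¹' E).indicator (fun _ : ℕ → N => (1 : ℝ))) :=
      stronglyMeasurable_const.indicator hEx
    have hcond : ∀ n, (fun η => h (orbit R η x n)) =ᵐ[μ]
        μ[(Prod.mk x ⁻¹' E).indicator (fun _ => (1 : ℝ)) | prefixFiltration n] := by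
      intro n
      have hmo : Measurable[prefixFiltration n] fun η : ℕ → N => h (orbit R η x n) :=
        hh_meas.comp (measurable_orbit hR x n)
      have hio : Integrable (fun η : ℕ → N => h (orbit R η x n)) μ :=
        Integrable.of_bound (hmo.mono (prefixFiltration.le n) le_rfl).aestronglyMeasurable 1
          (ae_of_all _ fun η => hh_bdd _)
      refine ae_eq_condExp_of_forall_setIntegral_eq (prefixFiltration.le n) hint
        (fun s _ _ => hio.integrableOn) ?_ hmo.aestronglyMeasurable
      intro s hs _
      have hs' : MeasurableSet s := prefixFiltration.le n s hs
      -- The pair records whether the test event `s` occurs and the current state. Both are known at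
      -- time `n`, so the integral over `s` becomes one against the product law of
      -- `map_prefix_shift`.
      set g : (ℕ → N) → ℝ × S := fun η => (s.indicator (fun _ => (1 : ℝ)) η, orbit R η x n)
      have hg : Measurable[prefixFiltration n] g :=
        (measurable_const.indicator hs).prodMk (measurable_orbit hR x n)
      have hg' : Measurable g := hg.mono (prefixFiltration.le n) le_rfl
      set k : (ℝ × S) × (ℕ → N) → ℝ :=
        fun q => q.1.1 * E.indicator (fun _ => (1 : ℝ)) (q.1.2, q.2)
      have hk : Measurable k := by
        have h1 : Measurable (E.indicator (fun _ => (1 : ℝ))) := measurable_const.indicator hE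
        exact (measurable_fst.comp measurable_fst).mul
          (h1.comp ((measurable_snd.comp measurable_fst).prodMk measurable_snd))
      have hpair : Measurable fun η : ℕ → N => (g η, fun k => η (k + n)) :=
        hg'.prodMk (by fun_prop)
      have key : ∀ η, k (g η, fun k => η (k + n)) =
          s.indicator ((Prod.mk x ⁻¹' E).indicator (fun _ => (1 : ℝ))) η := by
        intro η
        have h2 := hiter n x η
        by_cases h1 : η ∈ s <;> by_cases h3 : (x, η) ∈ E <;>
          simp [k, g, h1, h2, h3, Set.indicator]
      have hkint : Integrable k ((μ.map g).prod μ) := by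
        rw [hμ, ← map_prefix_shift lam hg, integrable_map_measure hk.aestronglyMeasurable
          hpair.aemeasurable]
        refine (hint.indicator hs').congr (ae_of_all _ fun η => ?_)
        exact (key η).symm
      rw [← integral_indicator hs', ← integral_indicator hs']
      calc ∫ η, s.indicator (fun η => h (orbit R η x n)) η ∂μ
          = ∫ η, (g η).1 * h (g η).2 ∂μ := by
            refine integral_congr_ae (ae_of_all _ fun η => ?_)
            by_cases h1 : η ∈ s <;> simp [g, h1]
        _ = ∫ y, y.1 * h y.2 ∂(μ.map g) := by
            rw [integral_map hg'.aemeasurable]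
            exact (measurable_fst.mul (hh_meas.comp measurable_snd)).aestronglyMeasurable
        _ = ∫ y, ∫ η, k (y, η) ∂μ ∂(μ.map g) := by
            refine integral_congr_ae (ae_of_all _ fun y => ?_)
            simp only [k]
            rw [integral_const_mul]
            congr 1
            have : (fun η : ℕ → N => E.indicator (fun _ => (1 : ℝ)) (y.2, η)) =
                (Prod.mk y.2 ⁻¹' E).indicator (fun _ => (1 : ℝ)) := rfl
            rw [this, integral_indicator (measurable_prodMk_left hE)]
            simp [h]
        _ = ∫ q, k q ∂((μ.map g).prod μ) := by
            have : IsProbabilityMeasure (μ.map g) := Measure.isProbabilityMeasure_map hg'.aemeasurable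
            rw [integral_prod _ hkint]
        _ = ∫ η, k (g η, fun k => η (k + n)) ∂μ := by
            rw [hμ, ← map_prefix_shift lam hg, integral_map hpair.aemeasurable
              hk.aestronglyMeasurable]
        _ = _ := integral_congr_ae (ae_of_all _ key)
    have hall := ae_all_iff.2 hcond
    filter_upwards [hall, Integrable.tendsto_ae_condExp (ℱ := prefixFiltration) hint
      (by rw [iSup_prefixFiltration]; exact hsm)] with η h1 h2
    exact h2.congr fun n => (h1 n).symm
  -- The level 1/2 separates the possible limits 0 and 1. One of `A` and its complement has positive
  -- `ψ`-measure, hence is visited infinitely often from everywhere, and this excludes one limit for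
  -- every `x` at once.
  set A : Set S := {x | 1 / 2 ≤ h x} with hA
  have hAm : MeasurableSet A := measurableSet_le measurable_const hh_meas
  rcases eq_or_ne (ψ A) 0 with h0 | h0
  · right
    have hc : 0 < ψ Aᶜ := by
      rw [pos_iff_ne_zero]
      intro h1
      apply hψ
      rw [← Measure.measure_univ_eq_zero, ← Set.union_compl_self A]
      exact measure_union_null h0 h1
    intro x
    filter_upwards [hrec _ hAm.compl hc x, hlevy x] with η h1 h2 h3
    rw [Set.indicator_of_mem (by exact h3)] at h2
    have : ∀ᶠ n in atTop, 1 / 2 < h (orbit R η x n) :=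
      h2.eventually (lt_mem_nhds (by norm_num))
    obtain ⟨n, h4, h5⟩ := (h1.and_eventually this).exists
    exact h4 h5.le
  · left
    intro x
    filter_upwards [hrec _ hAm (pos_iff_ne_zero.2 h0) x, hlevy x] with η h1 h2
    by_contra h3
    rw [Set.indicator_of_notMem (by exact h3)] at h2
    have : ∀ᶠ n in atTop, h (orbit R η x n) < 1 / 2 :=
      h2.eventually (gt_mem_nhds (by norm_num))
    obtain ⟨n, h4, h5⟩ := (h1.and_eventually this).exists
    exact absurd h4 (not_le.2 h5)

end Orbit

/-! ### A maximal ergodic inequality -/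

section Maximal

variable {α : Type*}

/-- The maximum of the first `n + 1` Birkhoff sums of `h`, written recursively. -/
def maxBirkhoffSum (T : α → α) (h : α → ℝ) : ℕ → α → ℝ
  | 0 => fun _ => 0
  | n + 1 => fun x => max 0 (h x + maxBirkhoffSum T h n (T x))

lemma maxBirkhoffSum_nonneg (T : α → α) (h : α → ℝ) (n : ℕ) (x : α) :
    0 ≤ maxBirkhoffSum T h n x := by
  cases n with
  | zero => exact le_rfl
  | succ n => exact le_max_left _ _

lemma maxBirkhoffSum_le_succ (T : α → α) (h : α → ℝ) (n : ℕ) (x : α) :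
    maxBirkhoffSum T h n x ≤ maxBirkhoffSum T h (n + 1) x := by
  induction n generalizing x with
  | zero => exact maxBirkhoffSum_nonneg T h 1 x
  | succ n ih => exact max_le_max le_rfl (by have := ih (T x); linarith)

lemma birkhoffSum_le_max (T : α → α) (h : α → ℝ) (n : ℕ) (x : α) :
    birkhoffSum T h n x ≤ maxBirkhoffSum T h n x := by
  induction n generalizing x with
  | zero => simp [maxBirkhoffSum]
  | succ n ih =>
    rw [birkhoffSum_succ']
    exact le_max_of_le_right (by have := ih (T x); linarith)

lemma integrable_maxBirkhoffSum [MeasurableSpace α] {μ : Measure α} [IsFiniteMeasure μ]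
    {T : α → α} (hT : MeasurePreserving T μ μ) {h : α → ℝ} (hh : Integrable h μ) (n : ℕ) :
    Integrable (maxBirkhoffSum T h n) μ := by
  induction n with
  | zero => exact integrable_const 0
  | succ n ih =>
    exact (integrable_const (0 : ℝ)).sup (hh.add (hT.integrable_comp_of_integrable ih))

/-- A form of the maximal ergodic theorem: if the Birkhoff sums of an integrable function are
almost everywhere unbounded above, then its integral is nonnegative. -/
theorem integral_nonneg_of_birkhoffSum_not_bddAbove [MeasurableSpace α] {μ : Measure α}
    [IsFiniteMeasure μ] {T : α → α} (hT : MeasurePreserving T μ μ) {h : α → ℝ}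
    (hh : Integrable h μ)
    (hunb : ∀ᵐ x ∂μ, ¬ BddAbove (Set.range fun n => birkhoffSum T h n x)) :
    0 ≤ ∫ x, h x ∂μ := by
  set m := maxBirkhoffSum T h with hm
  have hint := integrable_maxBirkhoffSum hT hh
  have hintT : ∀ n, Integrable (fun x => m n (T x)) μ := fun n =>
    hT.integrable_comp_of_integrable (hint n)
  -- After integration the left side is nonnegative, because `T` preserves `μ` and `m n` increases
  -- with `n`; the right side is bounded by `|h|` and becomes `h` for large `n`.
  have hdiff : ∀ n x, m (n + 1) x - m n (T x) = max (-m n (T x)) (h x) := by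
    intro n x
    change max 0 (h x + m n (T x)) - m n (T x) = _
    rw [max_sub_sub_right 0 (h x + m n (T x)) (m n (T x)) |>.symm]
    simp
  have hpos : ∀ n, 0 ≤ ∫ x, max (-m n (T x)) (h x) ∂μ := by
    intro n
    have h1 : ∫ x, max (-m n (T x)) (h x) ∂μ = ∫ x, m (n + 1) x ∂μ - ∫ x, m n (T x) ∂μ := by
      rw [← integral_sub (hint _) (hintT n)]
      exact integral_congr_ae (ae_of_all _ fun x => (hdiff n x).symm)
    have h2 : ∫ x, m n (T x) ∂μ = ∫ x, m n x ∂μ := by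
      conv_rhs => rw [← hT.map_eq]
      rw [integral_map hT.aemeasurable]
      rw [hT.map_eq]
      exact (hint n).aestronglyMeasurable
    rw [h1, h2]
    exact sub_nonneg.2 (integral_mono (hint n) (hint _) fun x => maxBirkhoffSum_le_succ T h n x)
  have hlim : Tendsto (fun n => ∫ x, max (-m n (T x)) (h x) ∂μ) atTop (𝓝 (∫ x, h x ∂μ)) := by
    refine tendsto_integral_of_dominated_convergence (fun x => |h x|)
      (fun n => ((hintT n).neg.sup hh).aestronglyMeasurable) hh.abs ?_ ?_
    · refine fun n => ae_of_all _ fun x => ?_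
      have h0 := maxBirkhoffSum_nonneg T h n (T x)
      rw [Real.norm_eq_abs, abs_le]
      refine ⟨(neg_abs_le _).trans (le_max_right _ _), max_le ?_ (le_abs_self _)⟩
      have := abs_nonneg (h x)
      linarith
    · filter_upwards [hunb] with x hx
      refine tendsto_const_nhds.congr' ?_
      -- Sums that are never positive would be bounded above by 0. A positive sum of length `k + 1`
      -- makes the sum from `T x` exceed `-h x`, so the truncation in the maximum disappears from
      -- then on.
      obtain ⟨k, hk⟩ : ∃ k, 0 < birkhoffSum T h k x := by
        by_contra! hc
        exact hx ⟨0, by rintro _ ⟨k, rfl⟩; exact hc k⟩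
      obtain ⟨k, hk⟩ : ∃ k, -h x ≤ m k (T x) := by
        cases k with
        | zero => simp at hk
        | succ k =>
          refine ⟨k, ?_⟩
          rw [birkhoffSum_succ'] at hk
          have := birkhoffSum_le_max T h k (T x)
          linarith
      filter_upwards [eventually_ge_atTop k] with n hn
      have hmono : Monotone fun n => m n (T x) :=
        monotone_nat_of_le_succ fun n => maxBirkhoffSum_le_succ T h n (T x)
      have := hmono hn
      simp only at this
      rw [max_eq_right (by linarith)]
  exact ge_of_tendsto' hlim hpos

end Maximal

/-! ### The law of large numbers from every starting point -/

lemma birkhoffSum_skew {N S : Type*} (R : N → S → S) (g : N × S → ℝ) (n : ℕ) (x : S) (η : ℕ → N) :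
    birkhoffSum (skew R) (fun p => g (p.2 0, p.1)) n (x, η) =
      ∑ i ∈ Finset.range n, g (η i, orbit R η x i) := by
  simp [birkhoffSum, skew_iterate]

section Law

variable {N S : Type*} [MeasurableSpace N] [MeasurableSpace S] (lam : Measure N)
  [IsProbabilityMeasure lam] {R : N → S → S}

/-- Passing from `x` to `T x` changes the sums only by the constant `h x` and an index shift. The
event is thus exactly invariant, not just up to a null set, as the zero-one law requires. -/
lemma bddAbove_birkhoffSum_comp {α : Type*} (T : α → α) (h : α → ℝ) (x : α) :
    BddAbove (Set.range fun n => birkhoffSum T h n (T x)) ↔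
      BddAbove (Set.range fun n => birkhoffSum T h n x) := by
  constructor
  · rintro ⟨C, hC⟩
    refine ⟨max 0 (h x + C), ?_⟩
    rintro _ ⟨n, rfl⟩
    cases n with
    | zero => simp
    | succ n =>
      simp only [birkhoffSum_succ']
      have : birkhoffSum T h n (T x) ≤ C := hC ⟨n, rfl⟩
      exact le_max_of_le_right (by linarith)
  · rintro ⟨C, hC⟩
    refine ⟨C - h x, ?_⟩
    rintro _ ⟨n, rfl⟩
    have : birkhoffSum T h (n + 1) x ≤ C := hC ⟨n + 1, rfl⟩
    rw [birkhoffSum_succ'] at this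
    simp only
    linarith

lemma measurableSet_bddAbove_birkhoffSum {α : Type*} [MeasurableSpace α] {T : α → α}
    (hT : Measurable T) {h : α → ℝ} (hh : Measurable h) :
    MeasurableSet {x | BddAbove (Set.range fun n => birkhoffSum T h n x)} := by
  refine measurableSet_bddAbove_range fun n => ?_
  unfold birkhoffSum
  exact Finset.measurable_sum _ fun i _ => hh.comp (hT.iterate i)

/-- Every `ψ`-positive set is almost surely visited infinitely often, from every starting point. -/
def Recurrent (R : N → S → S) (ψ : Measure S) : Prop :=
  ∀ A : Set S, MeasurableSet A → 0 < ψ A → ∀ x,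
    ∀ᵐ η ∂(Measure.infinitePi fun _ : ℕ => lam), ∃ᶠ n in atTop, orbit R η x n ∈ A

/-- Boundedness of the sums is an invariant event, so it is almost sure from all starting points or
almost surely false from all. The second case would make the integral nonnegative by the maximal
inequality. -/
lemma bddAbove_sum_of_integral_lt (hR : Measurable fun p : N × S => R p.1 p.2)
    {ψ : Measure S} (hψ : ψ ≠ 0) (hrec : Recurrent lam R ψ)
    {ν : Measure S} [IsProbabilityMeasure ν] (hν : (lam.prod ν).map (fun p => R p.1 p.2) = ν)
    {g : N × S → ℝ} (hg : Measurable g) (hgi : Integrable g (lam.prod ν))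
    (hneg : ∫ p, g p ∂(lam.prod ν) < 0) (x : S) :
    ∀ᵐ η ∂(Measure.infinitePi fun _ : ℕ => lam),
      BddAbove (Set.range fun n => ∑ i ∈ Finset.range n, g (η i, orbit R η x i)) := by
  set μ := Measure.infinitePi fun _ : ℕ => lam with hμ
  set G : S × (ℕ → N) → ℝ := fun p => g (p.2 0, p.1) with hG
  have hproj : MeasurePreserving (fun p : S × (ℕ → N) => (p.2 0, p.1)) (ν.prod μ) (lam.prod ν) := by
    have h1 : MeasurePreserving (fun η : ℕ → N => η 0) μ lam :=
      measurePreserving_eval_infinitePi (fun _ : ℕ => lam) 0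
    exact Measure.measurePreserving_swap.comp ((MeasurePreserving.id ν).prod h1)
  have hGm : Measurable G := hg.comp hproj.measurable
  have hGi : Integrable G (ν.prod μ) := hproj.integrable_comp_of_integrable hgi
  have hGint : ∫ p, G p ∂(ν.prod μ) = ∫ p, g p ∂(lam.prod ν) := by
    rw [← hproj.map_eq, integral_map hproj.aemeasurable hg.aestronglyMeasurable]
  rcases zero_one_of_recurrent lam hR hψ hrec
    (measurableSet_bddAbove_birkhoffSum (measurable_skew hR) hGm)
    (by ext p; exact bddAbove_birkhoffSum_comp (skew R) G p) with h | h
  · filter_upwards [h x] with η hη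
    simpa only [Set.mem_ofPred_eq, hG, birkhoffSum_skew] using hη
  · exfalso
    have hae : ∀ᵐ p ∂(ν.prod μ),
        p ∉ {p | BddAbove (Set.range fun n => birkhoffSum (skew R) G n p)} := by
      refine (Measure.ae_prod_iff_ae_ae
        (measurableSet_bddAbove_birkhoffSum (measurable_skew hR) hGm).compl).2 ?_
      exact ae_of_all _ h
    have := integral_nonneg_of_birkhoffSum_not_bddAbove (measurePreserving_skew lam hR hν) hGi hae
    linarith

lemma eventually_average_lt (hR : Measurable fun p : N × S => R p.1 p.2)
    {ψ : Measure S} (hψ : ψ ≠ 0) (hrec : Recurrent lam R ψ)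
    {ν : Measure S} [IsProbabilityMeasure ν] (hν : (lam.prod ν).map (fun p => R p.1 p.2) = ν)
    {g : N × S → ℝ} (hg : Measurable g) (hgi : Integrable g (lam.prod ν)) (x : S) :
    ∀ᵐ η ∂(Measure.infinitePi fun _ : ℕ => lam), ∀ b, ∫ p, g p ∂(lam.prod ν) < b →
      ∀ᶠ n : ℕ in atTop, (∑ i ∈ Finset.range n, g (η i, orbit R η x i)) / n < b := by
  set I := ∫ p, g p ∂(lam.prod ν)
  -- Subtracting slightly more than the mean makes the integral negative. Countably many margins `1
  -- / (k + 1)` suffice for one null set to serve all `b`.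
  have h : ∀ k : ℕ, ∀ᵐ η ∂(Measure.infinitePi fun _ : ℕ => lam), BddAbove (Set.range fun n =>
      ∑ i ∈ Finset.range n, (g (η i, orbit R η x i) - (I + 1 / ((k : ℝ) + 1)))) := by
    intro k
    refine bddAbove_sum_of_integral_lt lam hR hψ hrec hν
      (g := fun p => g p - (I + 1 / ((k : ℝ) + 1))) (hg.sub_const _)
      (hgi.sub (integrable_const _)) ?_ x
    rw [integral_sub hgi (integrable_const _)]
    have : (0 : ℝ) < 1 / ((k : ℝ) + 1) := by positivity
    simp only [integral_const, probReal_univ, one_smul]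
    change I - _ < 0
    linarith
  filter_upwards [ae_all_iff.2 h] with η hη b hb
  obtain ⟨k, hk⟩ := exists_nat_one_div_lt (sub_pos.2 hb)
  obtain ⟨C, hC⟩ := hη k
  have hlim : Tendsto (fun n : ℕ => C / n) atTop (𝓝 0) := tendsto_const_div_atTop_nhds_zero_nat C
  filter_upwards [hlim.eventually (gt_mem_nhds (by linarith : 0 < b - I - 1 / ((k : ℝ) + 1))),
    eventually_gt_atTop 0] with n h1 h2
  have h3 : ∑ i ∈ Finset.range n, (g (η i, orbit R η x i) - (I + 1 / ((k : ℝ) + 1))) ≤ C :=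
    hC ⟨n, rfl⟩
  rw [Finset.sum_sub_distrib] at h3
  simp only [Finset.sum_const, Finset.card_range, nsmul_eq_mul] at h3
  have hn : (0 : ℝ) < n := by exact_mod_cast h2
  rw [div_lt_iff₀ hn] at h1 ⊢
  nlinarith

/-- The law of large numbers for recurrent random iterations, from every starting point. -/
theorem tendsto_average_of_recurrent (hR : Measurable fun p : N × S => R p.1 p.2)
    {ψ : Measure S} (hψ : ψ ≠ 0) (hrec : Recurrent lam R ψ)
    {ν : Measure S} [IsProbabilityMeasure ν] (hν : (lam.prod ν).map (fun p => R p.1 p.2) = ν)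
    {g : N × S → ℝ} (hg : Measurable g) (hgi : Integrable g (lam.prod ν)) (x : S) :
    ∀ᵐ η ∂(Measure.infinitePi fun _ : ℕ => lam),
      Tendsto (fun n : ℕ => (∑ i ∈ Finset.range n, g (η i, orbit R η x i)) / n) atTop
        (𝓝 (∫ p, g p ∂(lam.prod ν))) := by
  filter_upwards [eventually_average_lt lam hR hψ hrec hν hg hgi x,
    eventually_average_lt lam hR hψ hrec hν hg.neg hgi.neg x] with η h1 h2
  refine tendsto_order.2 ⟨fun a ha => ?_, h1⟩
  have h3 : ∫ p, (-g) p ∂(lam.prod ν) < -a := by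
    simp only [Pi.neg_apply, integral_neg]
    linarith
  filter_upwards [h2 _ h3] with n hn
  simp only [Pi.neg_apply, Finset.sum_neg_distrib, neg_div] at hn
  linarith

end Law

end RandomIteration

namespace LorenzPDMP

/-! ### Deterministic renewal-reward limits -/

section Renewal

lemma tendsto_atTop_of_tendsto_div {σ : ℕ → ℝ} {m : ℝ} (hm : 0 < m)
    (hσ : Tendsto (fun n : ℕ => σ n / n) atTop (𝓝 m)) : Tendsto σ atTop atTop := by
  have h1 : Tendsto (fun n : ℕ => σ n / n * (n : ℝ)) atTop atTop :=
    hσ.pos_mul_atTop hm tendsto_natCast_atTop_atTop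
  refine h1.congr' ?_
  filter_upwards [eventually_gt_atTop 0] with n hn
  have : (n : ℝ) ≠ 0 := by exact_mod_cast hn.ne'
  field_simp

lemma exists_renewal_index {σ : ℕ → ℝ} (hσ : Tendsto σ atTop atTop) {t : ℝ} (ht : σ 0 ≤ t) :
    ∃ n, σ n ≤ t ∧ t < σ (n + 1) := by
  classical
  have hp : ∃ k, t < σ k := (hσ.eventually (eventually_gt_atTop t)).exists
  have h1 := Nat.find_spec hp
  have h2 : Nat.find hp ≠ 0 := fun h => by rw [h] at h1; linarith
  obtain ⟨n, hn⟩ := Nat.exists_eq_succ_of_ne_zero h2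
  exact ⟨n, not_lt.1 (Nat.find_min hp (by omega)), by rw [hn] at h1; exact h1⟩

/-- A renewal-reward theorem along a fixed trajectory. -/
lemma tendsto_time_average_of_renewal {F : ℝ → ℝ} {C : ℝ}
    (hF : ∀ t, 0 ≤ t → IntervalIntegrable F volume 0 t) (hC : ∀ s, 0 ≤ s → |F s| ≤ C)
    {σ : ℕ → ℝ} (h0 : 0 ≤ σ 0) (hmono : Monotone σ) {m γ : ℝ} (hm : 0 < m)
    (hσ : Tendsto (fun n : ℕ => σ n / n) atTop (𝓝 m))
    (hγ : Tendsto (fun n : ℕ => (∫ s in (0 : ℝ)..σ n, F s) / n) atTop (𝓝 γ)) :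
    Tendsto (fun t : ℝ => 1 / t * ∫ s in (0 : ℝ)..t, F s) atTop (𝓝 (γ / m)) := by
  have hσtop : Tendsto σ atTop atTop := tendsto_atTop_of_tendsto_div hm hσ
  have hex : ∀ t, ∃ n, σ 0 ≤ t → σ n ≤ t ∧ t < σ (n + 1) := by
    intro t
    by_cases ht : σ 0 ≤ t
    · obtain ⟨n, hn⟩ := exists_renewal_index hσtop ht
      exact ⟨n, fun _ => hn⟩
    · exact ⟨0, fun h => absurd h ht⟩
  -- `N t` is the index of the excursion in progress at time `t`; before `σ 0` its value is
  -- arbitrary.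
  choose N hN using hex
  have hNtop : Tendsto N atTop atTop := by
    refine tendsto_atTop.2 fun K => ?_
    filter_upwards [eventually_ge_atTop (σ 0), eventually_ge_atTop (σ K)] with t h1 h2
    by_contra h3
    have h4 := (hN t h1).2
    have := hmono (show N t + 1 ≤ K by omega)
    linarith
  have hσ' : Tendsto (fun n : ℕ => σ (n + 1) / n) atTop (𝓝 m) := by
    have h1 := (tendsto_add_atTop_iff_nat 1).2 hσ
    have h2 : Tendsto (fun n : ℕ => ((n : ℝ) + 1) / n) atTop (𝓝 1) := by
      have h3 : Tendsto (fun n : ℕ => 1 + 1 / (n : ℝ)) atTop (𝓝 (1 + 0)) :=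
        tendsto_const_nhds.add (tendsto_const_div_atTop_nhds_zero_nat 1)
      rw [add_zero] at h3
      refine h3.congr' ?_
      filter_upwards [eventually_gt_atTop 0] with n hn
      have : (n : ℝ) ≠ 0 := by exact_mod_cast hn.ne'
      field_simp
    have h4 := h1.mul h2
    rw [mul_one] at h4
    refine h4.congr' ?_
    filter_upwards [eventually_gt_atTop 0] with n hn
    have : (n : ℝ) ≠ 0 := by exact_mod_cast hn.ne'
    have : (n : ℝ) + 1 ≠ 0 := by positivity
    push_cast
    field_simp
  have hNpos : ∀ᶠ t in atTop, (0 : ℝ) < N t := by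
    filter_upwards [hNtop.eventually (eventually_gt_atTop 0)] with t ht
    exact_mod_cast ht
  -- Squeeze `t` between `σ (N t)` and `σ (N t + 1)`, which have the same asymptotic rate.
  have ht : Tendsto (fun t => t / (N t : ℝ)) atTop (𝓝 m) := by
    refine tendsto_of_tendsto_of_tendsto_of_le_of_le' (hσ.comp hNtop) (hσ'.comp hNtop) ?_ ?_
    · filter_upwards [hNpos, eventually_ge_atTop (σ 0)] with t h1 h2
      exact div_le_div_of_nonneg_right (hN t h2).1 h1.le
    · filter_upwards [hNpos, eventually_ge_atTop (σ 0)] with t h1 h2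
      exact div_le_div_of_nonneg_right (hN t h2).2.le h1.le
  -- The unfinished excursion contributes at most `C * (t - σ (N t))`, which is negligible against
  -- `N t`.
  have herr : Tendsto (fun t => (∫ s in (0 : ℝ)..t, F s) / N t -
      (∫ s in (0 : ℝ)..σ (N t), F s) / N t) atTop (𝓝 0) := by
    have h1 : Tendsto (fun t => C * (t / (N t : ℝ) - σ (N t) / N t)) atTop (𝓝 0) := by
      have h2 := (ht.sub (hσ.comp hNtop)).const_mul C
      rwa [sub_self, mul_zero] at h2
    refine squeeze_zero_norm' ?_ h1
    filter_upwards [hNpos, eventually_ge_atTop (σ 0)] with t h1 h2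
    have h3 := (hN t h2).1
    have h4 : 0 ≤ σ (N t) := h0.trans (hmono (Nat.zero_le _))
    rw [← sub_div, intervalIntegral.integral_interval_sub_left (hF t (h0.trans h2)) (hF _ h4),
      ← sub_div, ← mul_div_assoc, norm_div, Real.norm_of_nonneg h1.le]
    refine div_le_div_of_nonneg_right ?_ h1.le
    have h5 := intervalIntegral.norm_integral_le_of_norm_le_const (a := σ (N t)) (b := t) (f := F)
      (C := C) fun x hx => by
        rw [Set.uIoc_of_le h3] at hx
        exact hC x (h4.trans hx.1.le)
    rwa [abs_of_nonneg (sub_nonneg.2 h3)] at h5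
  have hnum : Tendsto (fun t => (∫ s in (0 : ℝ)..t, F s) / N t) atTop (𝓝 γ) := by
    have h1 := herr.add (hγ.comp hNtop)
    rw [zero_add] at h1
    exact h1.congr fun t => by simp
  refine (hnum.div ht hm.ne').congr' ?_
  filter_upwards [hNpos, eventually_gt_atTop 0] with t h1 h2
  simp only [Pi.div_apply]
  field_simp

/-- Time averages of a function that is given piecewise between renewal times. -/
lemma tendsto_time_average_of_pieces {F : ℝ → ℝ} {G : ℕ → ℝ → ℝ} {C : ℝ}
    {σ : ℕ → ℝ} (h0 : 0 ≤ σ 0) (hmono : Monotone σ)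
    (hF0C : ∀ s, 0 ≤ s → s < σ 0 → |F s| ≤ C) (hGC : ∀ n s, 0 ≤ s → |G n s| ≤ C)
    (hF0 : IntervalIntegrable F volume 0 (σ 0))
    (hG : ∀ n, IntervalIntegrable (G n) volume 0 (σ (n + 1) - σ n))
    (hFG : ∀ n, ∀ s, σ n ≤ s → s < σ (n + 1) → F s = G n (s - σ n)) {m γ : ℝ} (hm : 0 < m)
    (hσ : Tendsto (fun n : ℕ => σ n / n) atTop (𝓝 m))
    (hγ : Tendsto (fun n : ℕ =>
      (∑ i ∈ Finset.range n, ∫ s in (0 : ℝ)..(σ (i + 1) - σ i), G i s) / n) atTop (𝓝 γ)) :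
    (∀ t, 0 ≤ t → IntervalIntegrable F volume 0 t) ∧
      Tendsto (fun t : ℝ => 1 / t * ∫ s in (0 : ℝ)..t, F s) atTop (𝓝 (γ / m)) := by
  have hle : ∀ n, σ n ≤ σ (n + 1) := fun n => hmono n.le_succ
  have hpiece : ∀ n, IntervalIntegrable F volume (σ n) (σ (n + 1)) := by
    intro n
    have h1 := (hG n).comp_sub_right (σ n)
    rw [zero_add, sub_add_cancel] at h1
    -- Only the open interval is compared: at its right end `F` already follows the next piece.
    refine h1.congr_uIoo fun s hs => ?_
    rw [Set.uIoo_of_le (hle n)] at hs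
    exact (hFG n s hs.1.le hs.2).symm
  have hpint : ∀ n, ∫ s in σ n..σ (n + 1), F s = ∫ s in (0 : ℝ)..(σ (n + 1) - σ n), G n s := by
    intro n
    rw [intervalIntegral.integral_congr_Ioo_of_le (hle n)
      (fun s hs => hFG n s hs.1.le hs.2 : (Set.Ioo (σ n) (σ (n + 1))).EqOn F fun s => G n (s - σ n)),
      intervalIntegral.integral_comp_sub_right, sub_self]
  have hnode : ∀ n, IntervalIntegrable F volume 0 (σ n) := fun n =>
    hF0.trans (IntervalIntegrable.trans_iterate fun k _ => hpiece k)
  have hσtop : Tendsto σ atTop atTop := tendsto_atTop_of_tendsto_div hm hσ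
  have hF : ∀ t, 0 ≤ t → IntervalIntegrable F volume 0 t := by
    intro t ht
    obtain ⟨n, hn⟩ := (hσtop.eventually (eventually_ge_atTop t)).exists
    refine (hnode n).mono_set ?_
    rw [Set.uIcc_of_le ht, Set.uIcc_of_le (ht.trans hn)]
    exact Set.Icc_subset_Icc le_rfl hn
  have hC : ∀ s, 0 ≤ s → |F s| ≤ C := by
    intro s hs
    rcases lt_or_ge s (σ 0) with h | h
    · exact hF0C s hs h
    · obtain ⟨n, h1, h2⟩ := exists_renewal_index hσtop h
      rw [hFG n s h1 h2]
      exact hGC n _ (sub_nonneg.2 h1)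
  refine ⟨hF, tendsto_time_average_of_renewal hF hC h0 hmono hm hσ ?_⟩
  have h1 : Tendsto (fun n : ℕ => (∫ s in (0 : ℝ)..σ 0, F s) / n) atTop (𝓝 0) :=
    tendsto_const_div_atTop_nhds_zero_nat _
  have h2 := h1.add hγ
  rw [zero_add] at h2
  refine h2.congr fun n => ?_
  have h3 := intervalIntegral.sum_integral_adjacent_intervals (n := n) fun k _ => hpiece k
  simp only [hpint] at h3
  rw [← add_div, h3, intervalIntegral.integral_add_adjacent_intervals hF0
    (IntervalIntegrable.trans_iterate fun k _ => hpiece k)]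

end Renewal

/-! ### The process between consecutive renewals -/

section Trajectory

variable {ε : ℝ} {Φ : Noise ε → ℝ → Phase → Phase} {M : Set Phase}

lemma hittingTime_nonneg (a : Noise ε) (y : Phase) : 0 ≤ hittingTime Φ M a y :=
  Real.sInf_nonneg fun _ h => h.1

lemma returnTime_nonneg (a : Noise ε) (y : Phase) : 0 ≤ returnTime Φ M a y :=
  Real.sInf_nonneg fun _ h => h.1.le

lemma renewalTime_succ (η : ℕ → Noise ε) (x : Phase) (n : ℕ) :
    renewalTime Φ M η x (n + 1) =
      renewalTime Φ M η x n + returnTime Φ M (η n) (chain Φ M η x n) :=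
  Finset.sum_range_succ _ _

lemma monotone_renewalTime (η : ℕ → Noise ε) (x : Phase) : Monotone (renewalTime Φ M η x) :=
  monotone_nat_of_le_succ fun n => by
    rw [renewalTime_succ]
    exact le_add_of_nonneg_right (returnTime_nonneg _ _)

/-- Renewal times are only known to be nondecreasing. Strict inequality on the right still forces
the counted indices to be exactly those below `n`, even if some excursions have length zero. -/
lemma renewalCount_eq {η : ℕ → Noise ε} {x : Phase} {r : ℝ} {n : ℕ}
    (h1 : renewalTime Φ M η x n ≤ r) (h2 : r < renewalTime Φ M η x (n + 1)) :
    renewalCount Φ M η x r = n := by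
  have : {k : ℕ | renewalTime Φ M η x (k + 1) ≤ r} = Set.Iio n := by
    ext k
    change renewalTime Φ M η x (k + 1) ≤ r ↔ k < n
    constructor
    · intro hk
      by_contra hkn
      have := monotone_renewalTime (Φ := Φ) (M := M) η x (show n + 1 ≤ k + 1 by omega)
      linarith
    · intro hk
      exact (monotone_renewalTime (Φ := Φ) (M := M) η x (show k + 1 ≤ n by omega)).trans h1
  rw [renewalCount, this, Set.ncard_Iio_nat]

lemma pdmp_eq_of_lt {η : ℕ → Noise ε} {y : Phase} {t : ℝ}
    (h : t < hittingTime Φ M (η 0) y) : pdmp Φ M η y t = Φ (η 0) t y := if_pos h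

lemma pdmp_eq_of_mem {η : ℕ → Noise ε} {y x : Phase} {t : ℝ} {n : ℕ}
    (hx : Φ (η 0) (hittingTime Φ M (η 0) y) y = x)
    (h1 : hittingTime Φ M (η 0) y + renewalTime Φ M (fun k => η (k + 1)) x n ≤ t)
    (h2 : t < hittingTime Φ M (η 0) y + renewalTime Φ M (fun k => η (k + 1)) x (n + 1)) :
    pdmp Φ M η y t =
      Φ (η (n + 1)) (t - (hittingTime Φ M (η 0) y + renewalTime Φ M (fun k => η (k + 1)) x n))
        (chain Φ M (fun k => η (k + 1)) x n) := by
  have h0 : 0 ≤ renewalTime Φ M (fun k => η (k + 1)) x n :=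
    Finset.sum_nonneg fun i _ => returnTime_nonneg _ _
  have hc : renewalCount Φ M (fun k => η (k + 1)) x (t - hittingTime Φ M (η 0) y) = n :=
    renewalCount_eq (by linarith) (by linarith)
  rw [pdmp, if_neg (by linarith), hx, evolutionFromSection, age, hc, sub_sub]

end Trajectory

/-! ### Measurability of first zeros -/

section FirstZero

variable {X : Type*} [MeasurableSpace X] {D : X → ℝ → ENNReal}

/-- By compactness and continuity, a zero in the interval exists precisely when, for every `n`, some
rational in the interval enlarged by `1 / (n + 1)` gives a value below `1 / (n + 1)`. Only countably
many conditions remain. -/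
lemma measurableSet_exists_zero_Icc (hc : ∀ x, Continuous (D x))
    (hm : ∀ t, Measurable fun x => D x t) (a b : ℝ) :
    MeasurableSet {x | ∃ t ∈ Set.Icc a b, D x t = 0} := by
  have h : {x | ∃ t ∈ Set.Icc a b, D x t = 0} = ⋂ n : ℕ, ⋃ q : ℚ,
      {x | (q : ℝ) ∈ Set.Ioo (a - 1 / ((n : ℝ) + 1)) (b + 1 / ((n : ℝ) + 1)) ∧
        D x q < ((n : ENNReal) + 1)⁻¹} := by
    ext x
    rw [Set.mem_iInter]
    simp only [Set.mem_iUnion]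
    constructor
    · rintro ⟨t, ht, h0⟩ n
      have hn : (0 : ℝ) < 1 / ((n : ℝ) + 1) := by positivity
      have hopen : IsOpen (Set.Ioo (a - 1 / ((n : ℝ) + 1)) (b + 1 / ((n : ℝ) + 1)) ∩
          D x ⁻¹' Set.Iio ((n : ENNReal) + 1)⁻¹) :=
        isOpen_Ioo.inter (isOpen_Iio.preimage (hc x))
      obtain ⟨q, hq⟩ := Rat.denseRange_cast.exists_mem_open hopen
        ⟨t, ⟨by linarith [ht.1], by linarith [ht.2]⟩, by
          change D x t < _
          rw [h0, ENNReal.inv_pos]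
          finiteness⟩
      exact ⟨q, hq⟩
    · intro hx
      choose q hq hqD using hx
      have hq' : ∀ n, (q n : ℝ) ∈ Set.Icc (a - 1) (b + 1) := fun n => by
        have h1 : 1 / ((n : ℝ) + 1) ≤ 1 := by
          rw [div_le_one (by positivity)]
          linarith [n.cast_nonneg (α := ℝ)]
        exact ⟨by linarith [(hq n).1], by linarith [(hq n).2]⟩
      obtain ⟨t, -, k, hk, hlim⟩ := isCompact_Icc.tendsto_subseq hq'
      have h0 : Tendsto (fun n => 1 / (((k n : ℕ) : ℝ) + 1)) atTop (𝓝 0) :=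
        tendsto_one_div_add_atTop_nhds_zero_nat.comp hk.tendsto_atTop
      refine ⟨t, ⟨?_, ?_⟩, ?_⟩
      · simpa using le_of_tendsto_of_tendsto' ((tendsto_const_nhds (x := a)).sub h0) hlim (fun n => (hq (k n)).1.le)
      · simpa using le_of_tendsto_of_tendsto' hlim ((tendsto_const_nhds (x := b)).add h0) (fun n => (hq (k n)).2.le)
      · have h1 : Tendsto (fun n => D x (q (k n))) atTop (𝓝 (D x t)) :=
          ((hc x).tendsto t).comp hlim
        have h2 : Tendsto (fun n => (((k n : ℕ) : ENNReal) + 1)⁻¹) atTop (𝓝 0) := by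
          have h3 := (tendsto_add_atTop_iff_nat 1).2 ENNReal.tendsto_inv_nat_nhds_zero
          have h4 := h3.comp hk.tendsto_atTop
          refine h4.congr fun n => ?_
          simp
        exact le_antisymm (le_of_tendsto_of_tendsto' h1 h2 fun n => (hqD (k n)).le) zero_le
  rw [h]
  refine MeasurableSet.iInter fun n => MeasurableSet.iUnion fun q => ?_
  exact (MeasurableSet.const _).inter (measurableSet_lt (hm q) measurable_const)

/-- The first zero of a continuous function in a half-line is a measurable function of the
parameter. -/
lemma measurable_sInf_zero (hc : ∀ x, Continuous (D x)) (hm : ∀ t, Measurable fun x => D x t)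
    {J : Set ℝ} (hJ : ∀ t ∈ J, 0 ≤ t) {c : ℕ → ℝ} (hJc : ∀ t, t ∈ J ↔ ∃ k, c k ≤ t) :
    Measurable fun x => sInf {t | t ∈ J ∧ D x t = 0} := by
  have hbdd : ∀ x, BddBelow {t | t ∈ J ∧ D x t = 0} := fun x => ⟨0, fun t ht => hJ t ht.1⟩
  refine measurable_of_Iio fun s => ?_
  rcases le_or_gt s 0 with hs | hs
  · convert MeasurableSet.empty
    ext x
    simp only [Set.mem_preimage, Set.mem_Iio, Set.mem_empty_iff_false, iff_false, not_lt]
    exact hs.trans (Real.sInf_nonneg fun t ht => hJ t ht.1)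
  -- The complement on the right collects the parameters without any zero: there `sInf ∅ = 0`, which
  -- lies below the positive `s`.
  · have h : (fun x => sInf {t | t ∈ J ∧ D x t = 0}) ⁻¹' Set.Iio s =
        (⋃ k : ℕ, ⋃ j : ℕ, {x | ∃ t ∈ Set.Icc (c k) (j : ℝ), D x t = 0})ᶜ ∪
        ⋃ k : ℕ, ⋃ j : ℕ, {x | ∃ t ∈ Set.Icc (c k) (s - 1 / ((j : ℝ) + 1)), D x t = 0} := by
      ext x
      rw [Set.mem_union, Set.mem_compl_iff]
      simp only [Set.mem_iUnion]
      change sInf {t | t ∈ J ∧ D x t = 0} < s ↔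
        (¬ ∃ k : ℕ, ∃ j : ℕ, ∃ t ∈ Set.Icc (c k) (j : ℝ), D x t = 0) ∨
        ∃ k : ℕ, ∃ j : ℕ, ∃ t ∈ Set.Icc (c k) (s - 1 / ((j : ℝ) + 1)), D x t = 0
      constructor
      · intro hlt
        by_cases hne : {t | t ∈ J ∧ D x t = 0}.Nonempty
        · obtain ⟨t, ⟨htJ, ht0⟩, hts⟩ := exists_lt_of_csInf_lt hne hlt
          obtain ⟨k, hk⟩ := (hJc t).1 htJ
          obtain ⟨j, hj⟩ := exists_nat_one_div_lt (sub_pos.2 hts)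
          exact Or.inr ⟨k, j, t, ⟨hk, by linarith⟩, ht0⟩
        · left
          rintro ⟨k, j, t, ht, ht0⟩
          exact hne ⟨t, (hJc t).2 ⟨k, ht.1⟩, ht0⟩
      · rintro (hno | ⟨k, j, t, ht, ht0⟩)
        · have : {t | t ∈ J ∧ D x t = 0} = ∅ := by
            rw [Set.eq_empty_iff_forall_notMem]
            rintro t ⟨htJ, ht0⟩
            obtain ⟨k, hk⟩ := (hJc t).1 htJ
            obtain ⟨j, hj⟩ := exists_nat_ge t
            exact hno ⟨k, j, t, ⟨hk, hj⟩, ht0⟩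
          rw [this, Real.sInf_empty]
          exact hs
        · have h1 : sInf {t | t ∈ J ∧ D x t = 0} ≤ t :=
            csInf_le (hbdd x) ⟨(hJc t).2 ⟨k, ht.1⟩, ht0⟩
          have h2 : (0 : ℝ) < 1 / ((j : ℝ) + 1) := by positivity
          linarith [ht.2]
    rw [h]
    refine (MeasurableSet.iUnion fun k => MeasurableSet.iUnion fun j => ?_).compl.union
      (MeasurableSet.iUnion fun k => MeasurableSet.iUnion fun j => ?_)
    · exact measurableSet_exists_zero_Icc hc hm _ _
    · exact measurableSet_exists_zero_Icc hc hm _ _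

end FirstZero

/-! ### Measurability of the return data and rewards -/

section Flow

variable {ε : ℝ} {U M : Set Phase} {φ : Noise ε → Phase → Phase}
  {Φ : Noise ε → ℝ → Phase → Phase}

lemma IsSemiflowFamily.continuousOn (hΦ : IsSemiflowFamily U φ Φ) (a : Noise ε) {y : Phase}
    (hy : y ∈ U) : ContinuousOn (fun t => Φ a t y) (Set.Ici 0) :=
  fun t ht => (hΦ.hasDeriv a y hy t ht).continuousWithinAt

/-- The distance to `M` along an orbit, extended by a constant to negative times. -/
lemma IsSemiflowFamily.continuous_infEDist (hΦ : IsSemiflowFamily U φ Φ) (p : Noise ε × U) :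
    Continuous fun t => Metric.infEDist (Φ p.1 (max t 0) p.2) M := by
  refine Metric.continuous_infEDist.comp ?_
  exact (hΦ.continuousOn p.1 p.2.2).comp_continuous (by fun_prop) fun t => le_max_right t 0

lemma IsSemiflowFamily.measurable_flow (hΦ : IsSemiflowFamily U φ Φ) {X : Type*}
    [MeasurableSpace X] {a : X → Noise ε} {t : X → ℝ} {y : X → Phase} (ha : Measurable a)
    (ht : Measurable t) (hy : Measurable y) (ht0 : ∀ x, 0 ≤ t x) (hyU : ∀ x, y x ∈ U) :
    Measurable fun x => Φ (a x) (t x) (y x) := by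
  have h : Measurable fun x => (a x, (⟨t x, ht0 x⟩ : Set.Ici (0 : ℝ)), (⟨y x, hyU x⟩ : U)) :=
    ha.prodMk ((ht.subtype_mk).prodMk hy.subtype_mk)
  exact hΦ.measurable.comp h

lemma IsSemiflowFamily.measurable_infEDist (hΦ : IsSemiflowFamily U φ Φ) (t : ℝ) :
    Measurable fun p : Noise ε × U => Metric.infEDist (Φ p.1 (max t 0) p.2) M :=
  _root_.measurable_infEDist.comp (hΦ.measurable_flow measurable_fst measurable_const
    (by fun_prop) (fun _ => le_max_right t 0) fun p => p.2.2)

/-- As `M` is closed, visits to it are the zeros of the distance along the orbit, and the open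
half-line of times is exhausted by the closed ones starting at `1 / (k + 1)`. -/
lemma IsSemiflowFamily.measurable_returnTime (hΦ : IsSemiflowFamily U φ Φ) (hM : IsClosed M) :
    Measurable fun p : Noise ε × U => returnTime Φ M p.1 p.2 := by
  have h := measurable_sInf_zero (fun p => hΦ.continuous_infEDist (M := M) p)
    hΦ.measurable_infEDist (J := Set.Ioi 0) (fun t ht => le_of_lt ht)
    (c := fun k : ℕ => 1 / ((k : ℝ) + 1)) fun t => by
      constructor
      · intro ht
        obtain ⟨k, hk⟩ := exists_nat_one_div_lt (Set.mem_Ioi.1 ht)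
        exact ⟨k, hk.le⟩
      · rintro ⟨k, hk⟩
        exact lt_of_lt_of_le (by positivity) hk
  refine (congrArg Measurable (funext fun p => ?_)).mp h
  refine congrArg sInf (Set.ext fun t => and_congr_right fun ht => ?_)
  rw [max_eq_left (le_of_lt ht)]
  exact (Metric.mem_iff_infEDist_zero_of_closed hM).symm

lemma IsSemiflowFamily.measurable_hittingTime (hΦ : IsSemiflowFamily U φ Φ) (hM : IsClosed M) :
    Measurable fun p : Noise ε × U => hittingTime Φ M p.1 p.2 := by
  have h := measurable_sInf_zero (fun p => hΦ.continuous_infEDist (M := M) p)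
    hΦ.measurable_infEDist (J := Set.Ici 0) (fun t ht => ht) (c := fun _ : ℕ => 0)
    fun t => ⟨fun ht => ⟨0, ht⟩, fun ⟨_, ht⟩ => ht⟩
  refine (congrArg Measurable (funext fun p => ?_)).mp h
  refine congrArg sInf (Set.ext fun t => and_congr_right fun ht => ?_)
  rw [max_eq_left (Set.mem_Ici.1 ht)]
  exact (Metric.mem_iff_infEDist_zero_of_closed hM).symm

/-- The flow is in the closed set `M` at the first nonnegative time at which this happens. -/
lemma IsSemiflowFamily.flow_sInf_mem (hΦ : IsSemiflowFamily U φ Φ) (hM : IsClosed M)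
    (a : Noise ε) {y : Phase} (hy : y ∈ U) {S : Set ℝ} (hS : S.Nonempty)
    (hS0 : ∀ t ∈ S, 0 ≤ t ∧ Φ a t y ∈ M) : Φ a (sInf S) y ∈ M := by
  have hbdd : BddBelow S := ⟨0, fun t ht => (hS0 t ht).1⟩
  obtain ⟨u, -, hu, huS⟩ := exists_seq_tendsto_sInf hS hbdd
  have h0 : 0 ≤ sInf S := Real.sInf_nonneg fun t ht => (hS0 t ht).1
  have h1 : Tendsto (fun n => Φ a (u n) y) atTop (𝓝 (Φ a (sInf S) y)) :=
    ((hΦ.continuousOn a hy) _ h0).tendsto.comp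
      (tendsto_nhdsWithin_iff.2 ⟨hu, Eventually.of_forall fun n => (hS0 _ (huS n)).1⟩)
  exact hM.mem_of_tendsto h1 (Eventually.of_forall fun n => (hS0 _ (huS n)).2)

lemma IsSemiflowFamily.flow_hittingTime_mem (hΦ : IsSemiflowFamily U φ Φ) (hM : IsClosed M)
    {a : Noise ε} {y : Phase} (hy : y ∈ U) (h : ∃ t, 0 ≤ t ∧ Φ a t y ∈ M) :
    Φ a (hittingTime Φ M a y) y ∈ M :=
  hΦ.flow_sInf_mem hM a hy h fun _ ht => ht

/-- This holds for every noise, without exceptions: if there is no return, the return time is `sInf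
∅ = 0` and the map fixes `x`; if the infimum is not attained among positive times, closedness still
applies. -/
lemma IsSemiflowFamily.returnMap_mem (hΦ : IsSemiflowFamily U φ Φ) (hM : IsClosed M)
    (hMU : M ⊆ U) (a : Noise ε) {x : Phase} (hx : x ∈ M) : returnMap Φ M a x ∈ M := by
  unfold returnMap returnTime
  rcases Set.eq_empty_or_nonempty {t : ℝ | 0 < t ∧ Φ a t x ∈ M} with h | h
  · rw [h, Real.sInf_empty, hΦ.apply_zero a x (hMU hx)]
    exact hx
  · exact hΦ.flow_sInf_mem hM a (hMU hx) h fun t ht => ⟨ht.1.le, ht.2⟩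

/-- The return map as a self-map of the section. -/
noncomputable def sectionMap (hΦ : IsSemiflowFamily U φ Φ) (hM : IsClosed M) (hMU : M ⊆ U)
    (a : Noise ε) (x : M) : M :=
  ⟨returnMap Φ M a x, hΦ.returnMap_mem hM hMU a x.2⟩

lemma coe_orbit_sectionMap (hΦ : IsSemiflowFamily U φ Φ) (hM : IsClosed M) (hMU : M ⊆ U)
    (η : ℕ → Noise ε) (x : M) (n : ℕ) :
    ((RandomIteration.orbit (sectionMap hΦ hM hMU) η x n : M) : Phase) = chain Φ M η x n := by
  induction n with
  | zero => rfl
  | succ n ih =>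
    change returnMap Φ M (η n) ((RandomIteration.orbit (sectionMap hΦ hM hMU) η x n : M) : Phase) = _
    rw [ih]
    rfl

lemma measurable_sectionReturnTime (hΦ : IsSemiflowFamily U φ Φ) (hM : IsClosed M)
    (hMU : M ⊆ U) : Measurable fun p : Noise ε × M => returnTime Φ M p.1 p.2 :=
  (hΦ.measurable_returnTime hM).comp (g := fun p : Noise ε × U => returnTime Φ M p.1 p.2)
    (f := fun p : Noise ε × M => (p.1, (⟨p.2, hMU p.2.2⟩ : U))) (by fun_prop)

lemma measurable_sectionMap (hΦ : IsSemiflowFamily U φ Φ) (hM : IsClosed M) (hMU : M ⊆ U) :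
    Measurable fun p : Noise ε × M => sectionMap hΦ hM hMU p.1 p.2 :=
  Measurable.subtype_mk (hΦ.measurable_flow measurable_fst
    (measurable_sectionReturnTime hΦ hM hMU) (by fun_prop) (fun _ => returnTime_nonneg _ _)
    fun p => hMU p.2.2)

/-- The integral of `f` along the excursion that starts at `x ∈ M`. -/
noncomputable def reward (Φ : Noise ε → ℝ → Phase → Phase) (M : Set Phase) (f : Phase → ℝ)
    (a : Noise ε) (x : Phase) : ℝ :=
  ∫ s in (0 : ℝ)..returnTime Φ M a x, f (Φ a s x)

variable {f : Phase → ℝ}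

lemma IsSemiflowFamily.measurable_comp_flow (hΦ : IsSemiflowFamily U φ Φ)
    (hf : Measurable fun y : U => f y) {X : Type*}
    [MeasurableSpace X] {a : X → Noise ε} {t : X → ℝ} {y : X → Phase} (ha : Measurable a)
    (ht : Measurable t) (hy : Measurable y) (ht0 : ∀ x, 0 ≤ t x) (hyU : ∀ x, y x ∈ U) :
    Measurable fun x => f (Φ (a x) (t x) (y x)) :=
  hf.comp (g := fun y : U => f y)
    (f := fun x => ⟨Φ (a x) (t x) (y x), hΦ.mem_of_nonneg _ _ (hyU x) _ (ht0 x)⟩)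
    ((hΦ.measurable_flow ha ht hy ht0 hyU).subtype_mk)

lemma IsSemiflowFamily.intervalIntegrable_comp_flow (hΦ : IsSemiflowFamily U φ Φ)
    (hf : Measurable fun y : U => f y) {C : ℝ} (hC : ∀ y ∈ U, |f y| ≤ C) (a : Noise ε)
    {y : Phase} (hy : y ∈ U) {t : ℝ} (ht : 0 ≤ t) :
    IntervalIntegrable (fun s => f (Φ a s y)) volume 0 t := by
  -- Joint measurability of the flow is available for nonnegative times only, so time is truncated
  -- at 0.
  have h1 : Measurable fun s : ℝ => f (Φ a (max s 0) y) :=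
    hΦ.measurable_comp_flow hf measurable_const (by fun_prop) measurable_const
      (fun s => le_max_right s 0) fun _ => hy
  have h2 : IntervalIntegrable (fun s : ℝ => f (Φ a (max s 0) y)) volume 0 t := by
    refine (intervalIntegrable_const (c := C)).mono_fun h1.aestronglyMeasurable
      (ae_of_all _ fun s => ?_)
    exact (hC _ (hΦ.mem_of_nonneg a y hy _ (le_max_right s 0))).trans (le_abs_self C)
  refine h2.congr fun s hs => ?_
  rw [Set.uIoc_of_le ht] at hs
  simp only [max_eq_left hs.1.le]

lemma abs_reward_le (hΦ : IsSemiflowFamily U φ Φ) {C : ℝ} (hC : ∀ y ∈ U, |f y| ≤ C)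
    (a : Noise ε) {x : Phase} (hx : x ∈ U) : |reward Φ M f a x| ≤ C * returnTime Φ M a x := by
  have h0 : 0 ≤ returnTime Φ M a x := returnTime_nonneg a x
  have h := intervalIntegral.norm_integral_le_of_norm_le_const (a := 0)
    (b := returnTime Φ M a x) (f := fun s => f (Φ a s x)) (C := C) fun s hs => by
      rw [Set.uIoc_of_le h0] at hs
      exact hC _ (hΦ.mem_of_nonneg a x hx s hs.1.le)
  rwa [sub_zero, abs_of_nonneg h0] at h

lemma measurable_reward (hΦ : IsSemiflowFamily U φ Φ) (hM : IsClosed M) (hMU : M ⊆ U)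
    (hf : Measurable fun y : U => f y) :
    Measurable fun p : Noise ε × M => reward Φ M f p.1 p.2 := by
  have h1 : Measurable fun q : (Noise ε × M) × ℝ => f (Φ q.1.1 (max q.2 0) q.1.2) :=
    hΦ.measurable_comp_flow hf (by fun_prop) (by fun_prop) (by fun_prop)
      (fun q => le_max_right q.2 0) fun q => hMU q.1.2.2
  have h2 : MeasurableSet {q : (Noise ε × M) × ℝ | 0 < q.2 ∧ q.2 ≤ returnTime Φ M q.1.1 q.1.2} :=
    (measurableSet_lt measurable_const measurable_snd).inter (measurableSet_le measurable_snd
      ((measurable_sectionReturnTime hΦ hM hMU).comp measurable_fst))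
  have h3 := (h1.indicator h2).stronglyMeasurable
  have h4 := (StronglyMeasurable.integral_prod_right (ν := (volume : Measure ℝ))
    (f := fun (p : Noise ε × M) (s : ℝ) =>
      {q : (Noise ε × M) × ℝ | 0 < q.2 ∧ q.2 ≤ returnTime Φ M q.1.1 q.1.2}.indicator
        (fun q => f (Φ q.1.1 (max q.2 0) q.1.2)) (p, s)) h3).measurable
  convert h4 using 2 with p
  rw [reward, intervalIntegral.integral_of_le (returnTime_nonneg _ _),
    ← integral_indicator measurableSet_Ioc]
  refine integral_congr_ae (ae_of_all _ fun s => ?_)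
  by_cases hs : s ∈ Set.Ioc 0 (returnTime Φ M p.1 (p.2 : Phase))
  · have hs' : (p, s) ∈ {q : (Noise ε × M) × ℝ |
        0 < q.2 ∧ q.2 ≤ returnTime Φ M q.1.1 q.1.2} := hs
    simp only [Set.indicator_of_mem hs, Set.indicator_of_mem hs', max_eq_left hs.1.le]
  · have hs' : (p, s) ∉ {q : (Noise ε × M) × ℝ |
        0 < q.2 ∧ q.2 ≤ returnTime Φ M q.1.1 q.1.2} := hs
    simp only [Set.indicator_of_notMem hs, Set.indicator_of_notMem hs']

end Flow

/-! ### From the section to the process -/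

section Chain

variable {ε : ℝ} {U M : Set Phase} {φ : Noise ε → Phase → Phase}
  {Φ : Noise ε → ℝ → Phase → Phase} {lam : Measure (Noise ε)} {ν : Measure Phase}

lemma map_comap_subtype_eq (hMm : MeasurableSet M) (hν0 : ν Mᶜ = 0) :
    (ν.comap (Subtype.val : M → Phase)).map Subtype.val = ν := by
  rw [map_comap_subtype_coe hMm, Measure.restrict_eq_self_of_ae_mem]
  exact hν0

lemma IsStationary.isProbabilityMeasure_comap (hMm : MeasurableSet M)
    (hν : IsStationary Φ M lam ν) :
    IsProbabilityMeasure (ν.comap (Subtype.val : M → Phase)) := by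
  have := hν.isProbabilityMeasure
  refine ⟨?_⟩
  rw [← Set.preimage_univ (f := (Subtype.val : M → Phase)),
    ← Measure.map_apply measurable_subtype_coe MeasurableSet.univ,
    map_comap_subtype_eq hMm hν.compl_eq_zero, measure_univ]

/-- By Tonelli, integrating transition probabilities over `ν` computes the law of the image of an
independent pair of noise and state. -/
lemma IsStationary.map_sectionMap [IsProbabilityMeasure lam] (hν : IsStationary Φ M lam ν)
    (hΦ : IsSemiflowFamily U φ Φ) (hM : IsClosed M) (hMU : M ⊆ U) :
    (lam.prod (ν.comap (Subtype.val : M → Phase))).map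
      (fun p => sectionMap hΦ hM hMU p.1 p.2) = ν.comap (Subtype.val : M → Phase) := by
  have hMm : MeasurableSet M := hM.measurableSet
  have := hν.isProbabilityMeasure_comap hMm
  ext A hA
  have hA' : MeasurableSet ((Subtype.val : M → Phase) '' A) :=
    (MeasurableEmbedding.subtype_coe hMm).measurableSet_image.2 hA
  rw [Measure.map_apply (measurable_sectionMap hΦ hM hMU) hA,
    Measure.prod_apply_symm (measurable_sectionMap hΦ hM hMU hA),
    (MeasurableEmbedding.subtype_coe hMm).comap_apply, ← hν.lintegral_transition _ hA',
    ← lintegral_subtype_comap hMm]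
  refine lintegral_congr fun x => ?_
  congr 1
  ext a
  change sectionMap hΦ hM hMU a x ∈ A ↔ returnMap Φ M a x ∈ (Subtype.val : M → Phase) '' A
  constructor
  · exact fun h => ⟨_, h, rfl⟩
  · rintro ⟨z, hz, hzx⟩
    have : z = sectionMap hΦ hM hMU a x := Subtype.ext hzx
    rwa [← this]

lemma HarrisRecurrent.exists_recurrent [IsProbabilityMeasure lam] (h : HarrisRecurrent Φ M lam)
    (hΦ : IsSemiflowFamily U φ Φ) (hM : IsClosed M) (hMU : M ⊆ U) :
    ∃ ψ : Measure M, ψ ≠ 0 ∧ RandomIteration.Recurrent lam (sectionMap hΦ hM hMU) ψ := by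
  have hMm : MeasurableSet M := hM.measurableSet
  have hemb := MeasurableEmbedding.subtype_coe hMm
  obtain ⟨ψ, -, hψ, hrec⟩ := h
  refine ⟨ψ.comap Subtype.val, ?_, ?_⟩
  · intro h0
    have h1 := hemb.comap_apply ψ Set.univ
    rw [h0, Set.image_univ, Subtype.range_coe] at h1
    exact hψ.ne h1
  · intro A hA hA0 x
    rw [hemb.comap_apply] at hA0
    filter_upwards [hrec _ (hemb.measurableSet_image.2 hA) (Subtype.coe_image_subset _ _) hA0 x x.2]
      with η hη
    refine hη.mono fun n hn => ?_
    rw [← coe_orbit_sectionMap hΦ hM hMU] at hn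
    exact (Subtype.val_injective.mem_set_image).1 hn

lemma integrable_sectionReturnTime [IsProbabilityMeasure lam] (hMm : MeasurableSet M)
    (hν : IsStationary Φ M lam ν)
    (hτ : Integrable (fun p : Noise ε × Phase => returnTime Φ M p.1 p.2) (lam.prod ν)) :
    Integrable (fun p : Noise ε × M => returnTime Φ M p.1 p.2)
      (lam.prod (ν.comap Subtype.val)) := by
  have := hν.isProbabilityMeasure_comap hMm
  have h : MeasurePreserving (Prod.map id Subtype.val : Noise ε × M → Noise ε × Phase)
      (lam.prod (ν.comap Subtype.val)) (lam.prod ν) := by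
    have h1 : MeasurePreserving (Subtype.val : M → Phase) (ν.comap Subtype.val) ν :=
      ⟨measurable_subtype_coe, map_comap_subtype_eq hMm hν.compl_eq_zero⟩
    have := hν.isProbabilityMeasure
    exact (MeasurePreserving.id lam).prod h1
  exact h.integrable_comp_of_integrable hτ

lemma integrable_reward [IsProbabilityMeasure lam] (hΦ : IsSemiflowFamily U φ Φ)
    (hM : IsClosed M) (hMU : M ⊆ U) {f : Phase → ℝ}
    (hf : Measurable fun y : U => f y) {C : ℝ} (hC : ∀ y ∈ U, |f y| ≤ C)
    (hτ : Integrable (fun p : Noise ε × M => returnTime Φ M p.1 p.2)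
      (lam.prod (ν.comap Subtype.val))) :
    Integrable (fun p : Noise ε × M => reward Φ M f p.1 p.2)
      (lam.prod (ν.comap Subtype.val)) :=
  (hτ.const_mul C).mono' (measurable_reward hΦ hM hMU hf).aestronglyMeasurable
    (ae_of_all _ fun p => abs_reward_le hΦ hC p.1 (hMU p.2.2))

lemma integral_reward_eq [IsProbabilityMeasure lam] (hMm : MeasurableSet M)
    (hν : IsStationary Φ M lam ν) {f : Phase → ℝ}
    (hi : Integrable (fun p : Noise ε × M => reward Φ M f p.1 p.2)
      (lam.prod (ν.comap Subtype.val))) :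
    ∫ a, (∫ x in M, (∫ s in (0 : ℝ)..returnTime Φ M a x, f (Φ a s x)) ∂ν) ∂lam =
      ∫ p, reward Φ M f p.1 p.2 ∂(lam.prod (ν.comap (Subtype.val : M → Phase))) := by
  have := hν.isProbabilityMeasure_comap hMm
  rw [integral_prod _ hi]
  refine integral_congr_ae (ae_of_all _ fun a => ?_)
  exact (integral_subtype_comap hMm fun x => reward Φ M f a x).symm

/-- The mean return time, written with the distribution functions of the return times. -/
lemma integral_returnTimeCDF_eq [IsProbabilityMeasure lam] (hΦ : IsSemiflowFamily U φ Φ)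
    (hM : IsClosed M) (hMU : M ⊆ U) (hν : IsStationary Φ M lam ν)
    (hτ : Integrable (fun p : Noise ε × M => returnTime Φ M p.1 p.2)
      (lam.prod (ν.comap Subtype.val))) :
    ∫ x in M, (∫ s in Set.Ioi (0 : ℝ), (1 - returnTimeCDF Φ M lam s x)) ∂ν =
      ∫ p, returnTime Φ M p.1 p.2 ∂(lam.prod (ν.comap (Subtype.val : M → Phase))) := by
  have hMm : MeasurableSet M := hM.measurableSet
  have := hν.isProbabilityMeasure_comap hMm
  rw [integral_prod_symm _ hτ, ← integral_subtype_comap hMm]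
  refine integral_congr_ae ?_
  filter_upwards [hτ.prod_left_ae] with x hx
  -- Layer-cake formula: the mean of a nonnegative variable is the integral of its tail.
  rw [hx.integral_eq_integral_meas_lt (ae_of_all _ fun a => returnTime_nonneg _ _)]
  refine integral_congr_ae (ae_of_all _ fun s => ?_)
  have hm : Measurable fun a => returnTime Φ M a x :=
    (measurable_sectionReturnTime hΦ hM hMU).comp (measurable_id.prodMk measurable_const)
  have hs : MeasurableSet {a | returnTime Φ M a x ≤ s} := measurableSet_le hm measurable_const
  simp only [returnTimeCDF]
  rw [← probReal_compl_eq_one_sub hs]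
  congr 1
  ext a
  exact not_le (a := returnTime Φ M a x) (b := s)

lemma integral_returnTime_pos [IsProbabilityMeasure lam] (hΦ : IsSemiflowFamily U φ Φ)
    (hM : IsCrossSection Φ M U lam) (hν : IsStationary Φ M lam ν)
    (hτ : Integrable (fun p : Noise ε × M => returnTime Φ M p.1 p.2)
      (lam.prod (ν.comap Subtype.val))) :
    0 < ∫ p, returnTime Φ M p.1 p.2 ∂(lam.prod (ν.comap (Subtype.val : M → Phase))) := by
  have hMm : MeasurableSet M := hM.isClosed.measurableSet
  have := hν.isProbabilityMeasure_comap hMm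
  have hm := measurable_sectionReturnTime hΦ hM.isClosed hM.subset
  have hS : MeasurableSet {p : Noise ε × M | 0 < returnTime Φ M p.1 p.2} :=
    measurableSet_lt measurable_const hm
  have hpos : ∀ᵐ p ∂(lam.prod (ν.comap (Subtype.val : M → Phase))),
      0 < returnTime Φ M p.1 p.2 := by
    refine (Measure.ae_prod_iff_ae_ae hS).2 ?_
    -- Returns are almost sure in the noise for each fixed `x`, so the order of the quantifiers must
    -- be exchanged.
    refine (Measure.ae_ae_comm (p := fun (a : Noise ε) (x : M) => 0 < returnTime Φ M a x) hS).2
      (ae_of_all _ fun x => ?_)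
    filter_upwards [hM.returns x x.2] with a ⟨t, ht⟩
    rw [returnTime, ht.csInf_eq]
    exact ht.1.1
  have hnn : 0 ≤ ∫ p, returnTime Φ M p.1 p.2 ∂(lam.prod (ν.comap (Subtype.val : M → Phase))) :=
    integral_nonneg fun p => returnTime_nonneg _ _
  refine lt_of_le_of_ne hnn fun h0 => ?_
  rw [eq_comm, integral_eq_zero_iff_of_nonneg (fun p => returnTime_nonneg _ _) hτ] at h0
  obtain ⟨p, h1, h2⟩ := (hpos.and h0).exists
  exact h1.ne' h2

/-- The time averages along a trajectory whose renewal times and rewards obey the law of large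
numbers from the hitting point on. -/
lemma pdmp_time_average (hΦ : IsSemiflowFamily U φ Φ) (hM : IsClosed M) (hMU : M ⊆ U)
    {f : Phase → ℝ} (hf : Measurable fun y : U => f y) {C : ℝ} (hC : ∀ y ∈ U, |f y| ≤ C)
    {y : Phase} (hy : y ∈ U) {η : ℕ → Noise ε} {x : Phase} (hxM : x ∈ M)
    (hx : Φ (η 0) (hittingTime Φ M (η 0) y) y = x) {m γ : ℝ} (hm : 0 < m)
    (h1 : Tendsto (fun n : ℕ => renewalTime Φ M (fun k => η (k + 1)) x n / n) atTop (𝓝 m))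
    (h2 : Tendsto (fun n : ℕ => (∑ i ∈ Finset.range n,
      reward Φ M f (η (i + 1)) (chain Φ M (fun k => η (k + 1)) x i)) / n) atTop (𝓝 γ)) :
    (∀ t : ℝ, 0 ≤ t → IntervalIntegrable (fun s => f (pdmp Φ M η y s)) volume 0 t) ∧
      Tendsto (fun t : ℝ => 1 / t * ∫ s in (0 : ℝ)..t, f (pdmp Φ M η y s)) atTop
        (𝓝 (γ / m)) := by
  have hchain : ∀ n, chain Φ M (fun k => η (k + 1)) x n ∈ U := fun n => by
    have h := coe_orbit_sectionMap hΦ hM hMU (fun k => η (k + 1)) ⟨x, hxM⟩ n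
    rw [← h]
    exact hMU (Subtype.coe_prop _)
  have hT := hittingTime_nonneg (Φ := Φ) (M := M) (η 0) y
  set T := hittingTime Φ M (η 0) y with hTdef
  have hT0 : T + renewalTime Φ M (fun k => η (k + 1)) x 0 = T := by simp [renewalTime]
  have hstep : ∀ n, T + renewalTime Φ M (fun k => η (k + 1)) x (n + 1) -
      (T + renewalTime Φ M (fun k => η (k + 1)) x n) =
      returnTime Φ M (η (n + 1)) (chain Φ M (fun k => η (k + 1)) x n) := fun n => by
    rw [renewalTime_succ]
    ring
  refine tendsto_time_average_of_pieces (C := C)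
    (σ := fun n => T + renewalTime Φ M (fun k => η (k + 1)) x n)
    (G := fun n s => f (Φ (η (n + 1)) (max s 0) (chain Φ M (fun k => η (k + 1)) x n)))
    ?_ ?_ ?_ ?_ ?_ ?_ ?_ hm ?_ ?_
  · rw [hT0]
    exact hT
  · exact fun i j hij => add_le_add le_rfl (monotone_renewalTime _ _ hij)
  · intro s hs hsT
    rw [hT0] at hsT
    rw [pdmp_eq_of_lt hsT]
    exact hC _ (hΦ.mem_of_nonneg _ y hy s hs)
  · exact fun n s _ => hC _ (hΦ.mem_of_nonneg _ _ (hchain n) _ (le_max_right s 0))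
  · rw [hT0]
    refine (hΦ.intervalIntegrable_comp_flow hf hC (η 0) hy hT).congr_uIoo fun s hs => ?_
    rw [Set.uIoo_of_le hT] at hs
    simp only [pdmp_eq_of_lt hs.2]
  · intro n
    simp only [hstep]
    refine (hΦ.intervalIntegrable_comp_flow hf hC (η (n + 1)) (hchain n)
      (returnTime_nonneg _ _)).congr fun s hs => ?_
    rw [Set.uIoc_of_le (returnTime_nonneg _ _)] at hs
    simp only [max_eq_left hs.1.le]
  · intro n s hs1 hs2
    rw [pdmp_eq_of_mem hx hs1 hs2, max_eq_left (sub_nonneg.2 hs1)]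
  · have h3 := (tendsto_const_div_atTop_nhds_zero_nat T).add h1
    rw [zero_add] at h3
    exact h3.congr fun n => (add_div _ _ _).symm
  · refine h2.congr fun n => ?_
    congr 1
    refine Finset.sum_congr rfl fun i _ => ?_
    simp only [hstep]
    refine intervalIntegral.integral_congr fun s hs => ?_
    rw [Set.uIcc_of_le (returnTime_nonneg _ _)] at hs
    simp only [max_eq_left hs.1]

/-- Joint measurability in the starting point and the noise is needed to apply Fubini with a random
starting point. -/
lemma measurable_average_orbit {N S : Type*} [MeasurableSpace N] [MeasurableSpace S]
    {R : N → S → S} (hR : Measurable fun p : N × S => R p.1 p.2) {g : N × S → ℝ}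
    (hg : Measurable g) (n : ℕ) :
    Measurable fun q : S × (ℕ → N) =>
      (∑ i ∈ Finset.range n, g (q.2 i, RandomIteration.orbit R q.2 q.1 i)) / n := by
  simp only [← RandomIteration.birkhoffSum_skew]
  refine Measurable.div_const (Finset.measurable_sum _ fun i _ => ?_) _
  have h : Measurable fun p : S × (ℕ → N) => g (p.2 0, p.1) := hg.comp (by fun_prop)
  exact h.comp ((RandomIteration.measurable_skew hR).iterate i)

/-- The ergodic theorem for the process driven by the coordinates of the sequence space. -/
theorem ae_pdmp_time_average [IsProbabilityMeasure lam]
    (hΦ : IsSemiflowFamily U φ Φ) (hM : IsCrossSection Φ M U lam)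
    (hHarris : HarrisRecurrent Φ M lam) (hν : IsStationary Φ M lam ν)
    (hτ : Integrable (fun p : Noise ε × M => returnTime Φ M p.1 p.2)
      (lam.prod (ν.comap Subtype.val)))
    {f : Phase → ℝ} (hf : Measurable fun y : U => f y) {C : ℝ} (hC : ∀ y ∈ U, |f y| ≤ C)
    {y : Phase} (hy : y ∈ U) :
    ∀ᵐ η ∂(Measure.infinitePi fun _ : ℕ => lam),
      (∀ t : ℝ, 0 ≤ t → IntervalIntegrable (fun s => f (pdmp Φ M η y s)) volume 0 t) ∧
      Tendsto (fun t : ℝ => 1 / t * ∫ s in (0 : ℝ)..t, f (pdmp Φ M η y s)) atTop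
        (𝓝 ((∫ p, reward Φ M f p.1 p.2 ∂(lam.prod (ν.comap (Subtype.val : M → Phase)))) /
          ∫ p, returnTime Φ M p.1 p.2 ∂(lam.prod (ν.comap (Subtype.val : M → Phase))))) := by
  have hMc := hM.isClosed
  have hMU := hM.subset
  have hMm : MeasurableSet M := hMc.measurableSet
  have := hν.isProbabilityMeasure_comap hMm
  set ν' := ν.comap (Subtype.val : M → Phase)
  set μ := Measure.infinitePi fun _ : ℕ => lam with hμ
  set R := sectionMap hΦ hMc hMU
  have hR : Measurable fun p : Noise ε × M => R p.1 p.2 := measurable_sectionMap hΦ hMc hMU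
  obtain ⟨ψ, hψ, hrec⟩ := hHarris.exists_recurrent hΦ hMc hMU
  have hstat := hν.map_sectionMap hΦ hMc hMU
  have hτm := measurable_sectionReturnTime hΦ hMc hMU
  have hrm := measurable_reward hΦ hMc hMU hf
  have hri := integrable_reward (ν := ν) hΦ hMc hMU hf hC hτ
  set m := ∫ p, returnTime Φ M p.1 p.2 ∂(lam.prod ν')
  set γ := ∫ p, reward Φ M f p.1 p.2 ∂(lam.prod ν')
  set G : Set (M × (ℕ → Noise ε)) :=
    {q | Tendsto (fun n : ℕ => (∑ i ∈ Finset.range n,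
      returnTime Φ M (q.2 i) (RandomIteration.orbit R q.2 q.1 i : M)) / n) atTop (𝓝 m)} ∩
    {q | Tendsto (fun n : ℕ => (∑ i ∈ Finset.range n,
      reward Φ M f (q.2 i) (RandomIteration.orbit R q.2 q.1 i : M)) / n) atTop (𝓝 γ)} with hG
  have hGm : MeasurableSet G :=
    (measurableSet_tendsto _ (measurable_average_orbit hR hτm)).inter
      (measurableSet_tendsto _ (measurable_average_orbit hR hrm))
  have hGae : ∀ x : M, ∀ᵐ η ∂μ, (x, η) ∈ G := by
    intro x
    filter_upwards [RandomIteration.tendsto_average_of_recurrent lam hR hψ hrec hstat hτm hτ x,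
      RandomIteration.tendsto_average_of_recurrent lam hR hψ hrec hstat hrm hri x] with η h1 h2
    exact ⟨h1, h2⟩
  -- The hitting point lies in `M` only almost surely, so the good set is transported from the
  -- section to the whole phase space.
  set G' : Set (Phase × (ℕ → Noise ε)) := Prod.map Subtype.val id '' G with hG'
  have hG'm : MeasurableSet G' :=
    ((MeasurableEmbedding.subtype_coe hMm).prodMap MeasurableEmbedding.id).measurableSet_image.2 hGm
  have hhit : Measurable fun a : Noise ε => Φ a (hittingTime Φ M a y) y :=
    hΦ.measurable_flow measurable_id
      ((hΦ.measurable_hittingTime hMc).comp (measurable_id.prodMk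
        (measurable_const (a := (⟨y, hy⟩ : U))))) measurable_const
      (fun _ => hittingTime_nonneg _ _) fun _ => hy
  -- With the first noise frozen the hitting point is deterministic, and the law of large numbers
  -- from every point of `M` applies to the later noises.
  have hprod : ∀ᵐ q ∂(lam.prod μ), (Φ q.1 (hittingTime Φ M q.1 y) y, q.2) ∈ G' := by
    have hS : MeasurableSet {q : Noise ε × (ℕ → Noise ε) |
        (Φ q.1 (hittingTime Φ M q.1 y) y, q.2) ∈ G'} :=
      ((hhit.comp measurable_fst).prodMk measurable_snd) hG'm
    refine (Measure.ae_prod_iff_ae_ae hS).2 ?_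
    filter_upwards [hM.hits y hy] with a ha
    filter_upwards [hGae ⟨_, hΦ.flow_hittingTime_mem hMc hy ha⟩] with η hη
    exact ⟨_, hη, rfl⟩
  have hmap : μ.map (fun η => (η 0, fun k => η (k + 1))) = lam.prod μ := by
    rw [hμ, RandomIteration.map_prefix_shift lam (n := 1) (g := fun η : ℕ → Noise ε => η 0)
      (RandomIteration.measurable_eval_prefixFiltration Nat.one_pos), Measure.infinitePi_map_eval]
  rw [← hmap] at hprod
  have hpm : Measurable fun η : ℕ → Noise ε => (η 0, fun k => η (k + 1)) := by fun_prop
  filter_upwards [ae_of_ae_map hpm.aemeasurable hprod] with η hη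
  obtain ⟨⟨x, η'⟩, hxG, hxe⟩ := hη
  simp only [Prod.map, id, Prod.mk.injEq] at hxe
  obtain ⟨hx, rfl⟩ := hxe
  refine pdmp_time_average hΦ hMc hMU hf hC hy x.2 hx.symm
    (integral_returnTime_pos hΦ hM hν hτ) ?_ ?_
  · refine hxG.1.congr fun n => ?_
    simp only [renewalTime, R, coe_orbit_sectionMap]
  · refine hxG.2.congr fun n => ?_
    simp only [R, coe_orbit_sectionMap]

end Chain

end LorenzPDMP

theorem mainTheorem6 {ε : ℝ} (U M : Set LorenzPDMP.Phase) (hU : IsOpen U)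
    (φ : LorenzPDMP.Noise ε → LorenzPDMP.Phase → LorenzPDMP.Phase)
    (Φ : LorenzPDMP.Noise ε → ℝ → LorenzPDMP.Phase → LorenzPDMP.Phase)
    (hΦ : LorenzPDMP.IsSemiflowFamily U φ Φ)
    (lam : Measure (LorenzPDMP.Noise ε)) [IsProbabilityMeasure lam]
    (hM : LorenzPDMP.IsCrossSection Φ M U lam)
    (hHarris : LorenzPDMP.HarrisRecurrent Φ M lam)
    (ν : Measure LorenzPDMP.Phase) (hν : LorenzPDMP.IsStationary Φ M lam ν)
    (hτ : Integrable
      (fun p : LorenzPDMP.Noise ε × LorenzPDMP.Phase => LorenzPDMP.returnTime Φ M p.1 p.2)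
      (lam.prod ν))
    {Ω : Type*} [MeasurableSpace Ω] (P : Measure Ω) [IsProbabilityMeasure P]
    (η : ℕ → Ω → LorenzPDMP.Noise ε) (hη_meas : ∀ i, Measurable (η i))
    (hη_indep : iIndepFun η P) (hη_law : ∀ i, P.map (η i) = lam)
    (f : LorenzPDMP.Phase → ℝ) (hf_meas : Measurable fun y : U => f y)
    (hf_bdd : ∃ C : ℝ, ∀ y ∈ U, |f y| ≤ C)
    (y₀ : LorenzPDMP.Phase) (hy₀ : y₀ ∈ U) :
    0 < ∫ x in M, (∫ s in Set.Ioi (0 : ℝ), (1 - LorenzPDMP.returnTimeCDF Φ M lam s x)) ∂ν ∧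
    ∀ᵐ ω ∂P,
      (∀ t : ℝ, 0 ≤ t → IntervalIntegrable
        (fun s => f (LorenzPDMP.pdmp Φ M (fun i => η i ω) y₀ s)) volume 0 t) ∧
      Tendsto
        (fun t : ℝ => 1 / t * ∫ s in (0 : ℝ)..t, f (LorenzPDMP.pdmp Φ M (fun i => η i ω) y₀ s))
        atTop
        (𝓝 ((∫ a, (∫ x in M, (∫ s in (0 : ℝ)..LorenzPDMP.returnTime Φ M a x, f (Φ a s x)) ∂ν) ∂lam) /
          ∫ x in M, (∫ s in Set.Ioi (0 : ℝ), (1 - LorenzPDMP.returnTimeCDF Φ M lam s x)) ∂ν)) := by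
  obtain ⟨C, hC⟩ := hf_bdd
  have hMm : MeasurableSet M := hM.isClosed.measurableSet
  have hτ' := LorenzPDMP.integrable_sectionReturnTime hMm hν hτ
  have hr := LorenzPDMP.integrable_reward (ν := ν) hΦ hM.isClosed hM.subset hf_meas hC hτ'
  rw [LorenzPDMP.integral_reward_eq hMm hν hr,
    LorenzPDMP.integral_returnTimeCDF_eq hΦ hM.isClosed hM.subset hν hτ']
  refine ⟨LorenzPDMP.integral_returnTime_pos hΦ hM hν hτ', ?_⟩
  -- The almost sure statement concerns the noise sequence alone, so it can be transferred from the
  -- sequence space to `Ω`.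
  have hlaw : P.map (fun ω i => η i ω) = Measure.infinitePi fun _ : ℕ => lam := by
    rw [(iIndepFun_iff_map_fun_eq_infinitePi_map hη_meas).1 hη_indep]
    simp only [hη_law]
  have hae := LorenzPDMP.ae_pdmp_time_average hΦ hM hHarris hν hτ' hf_meas hC hy₀
  rw [← hlaw] at hae
  exact ae_of_ae_map (measurable_pi_lambda _ hη_meas).aemeasurable hae
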